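/- Let $M_0$ be a free abelian group with basis $b_0,b_1,b_2,\dots$, and put $b_k=0$ for $k<0$. For $s\ge 0$ let $\mathcal G_s\subseteq\bigwedge^sM_0$ be the Grassmann cone, i.e. the set of all $m_1\wedge\cdots\wedge m_s$ with $m_i\in M_0$. Let $\sigma_-(z),\overline\sigma_-(z):\bigwedge M_0\to(\bigwedge M_0)[z^{-1}]$ be the unique algebra homomorphisms with $\sigma_-(z)b_i=\sum_{j\ge0}b_{i-j}z^{-j}$ and $\overline\sigma_-(z)b_i=b_i-b_{i-1}z^{-1}$; they are inverse to each other when extended $z^{-1}$-linearly. Let $B_s=\mathbb Z[e_1,\dots,e_s]$, $B_\infty=\mathbb Z[e_1,e_2,\dots]$, $E_s(z)=1-e_1z+\cdots+(-1)^se_sz^s$, $E_\infty(z)=1+\sum_{i\ge1}(-1)^ie_iz^i$. For $s\in\mathbb N\cup\{\infty\}$ let $h_n\in B_s$ be the coefficients of $E_s(z)^{-1}=\sum_{n\ge0}h_nz^n$, with $h_n=0$ for $n<0$. For a partition $\lambda=(\lambda_1\ge\lambda_2\ge\cdots)$ of length $\ell(\lambda)\le s$ let $\Delta_\lambda(H_s)=\det(h_{\lambda_j-j+i})_{1\le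 i,j\le s}\in B_s$ and $[\mathbf b]^s_\lambda=b_{\lambda_s}\wedge b_{1+\lambda_{s-1}}\wedge\cdots\wedge b_{s-1+\lambda_1}\in\bigwedge^sM_0$; for $s=\infty$ the determinant has size $\ell(\lambda)$. The $\Delta_\lambda(H_s)$ with $\ell(\lambda)\le s$ form a $\mathbb Z$-basis of $B_s$ (all $\lambda$ if $s=\infty$), and for finite $s$ the $[\mathbf b]^s_\lambda$ form a $\mathbb Z$-basis of $\bigwedge^sM_0$. Let $\phi_s:B_s\to\bigwedge^sM_0$ be the isomorphism of abelian groups with $\phi_s(\Delta_\lambda(H_s))=[\mathbf b]^s_\lambda$. Let $\sigma_-(z),\overline\sigma_-(z)$ also denote the additive maps $B_\infty\to B_\infty[z^{-1}]$ that send $\Delta_\lambda(H_\infty)$ to $\sum_\mu a_\mu(z^{-1})\Delta_\mu(H_\infty)$, where $\sum_\mu a_\mu(z^{-1})[\mathbf b]^s_\mu$ is $\sigma_-(z)[\mathbf b]^s_\lambda$, respectively $\overline\sigma_-(z)[\mathbf b]^s_\lambda$; this does not depend on the choice of $s\ge\ell(\lambda)$. We say that $p\in B_\infty$ corresponds to an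 element of the Grassmann cone $\mathcal G_\infty$ if, for all sufficiently large $s$, $p\in B_s$ and $\phi_s(p)\in\mathcal G_s$. For $f=\sum_i f_iz^i$ and $g=\sum_j g_jz^j$ in $B_\infty((z))$ write $f\otimes g=\sum_n\big(\sum_{i+j=n}f_i\otimes g_j\big)z^n\in(B_\infty\otimes_{\mathbb Z}B_\infty)((z))$, and let $\mathrm{Res}_z$ denote the coefficient of $z^{-1}$. Then $p\in B_\infty$ corresponds to an element of $\mathcal G_\infty$ if and only if $$\mathrm{Res}_z\Big(E_\infty(z)\,\sigma_-(z)p\;\otimes_{\mathbb Z}\;\frac1{E_\infty(z)}\,\overline\sigma_-(z)p\Big)=0 .$$ -/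

import Mathlib

open scoped TensorProduct

noncomputable section

namespace GrassmannKP

/-! ### The free abelian group `M₀`, its exterior algebra, and Schubert derivations -/

/-- The free abelian group of countable rank. -/
abbrev M₀ : Type := ℕ →₀ ℤ

/-- The basis `b₀, b₁, …` of `M₀`. -/
def b (i : ℕ) : M₀ := Finsupp.single i 1

/-- The exterior algebra `⋀ M₀`. -/
abbrev Ext : Type := ExteriorAlgebra ℤ M₀

/-- The inclusion `M₀[w] → (⋀ M₀)[w]`; an element of `M₀[w]` is the finitely supported family of
its coefficients. -/
def toExtPoly : (ℕ →₀ M₀) →ₗ[ℤ] Polynomial Ext :=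
  Finsupp.lsum ℤ fun j =>
    ((Polynomial.monomial j : Ext →ₗ[Ext] Polynomial Ext).restrictScalars ℤ).comp
      (ExteriorAlgebra.ι ℤ)

theorem toExtPoly_single (j : ℕ) (m : M₀) :
    toExtPoly (Finsupp.single j m) = Polynomial.monomial j (ExteriorAlgebra.ι ℤ m) := by
  simp [toExtPoly]

theorem toExtPoly_anticomm (x y : ℕ →₀ M₀) :
    toExtPoly x * toExtPoly y + toExtPoly y * toExtPoly x = 0 := by
  induction x using Finsupp.induction_linear with
  | zero => simp
  | add x₁ x₂ h₁ h₂ =>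
    calc _ = (toExtPoly x₁ * toExtPoly y + toExtPoly y * toExtPoly x₁)
          + (toExtPoly x₂ * toExtPoly y + toExtPoly y * toExtPoly x₂) := by
            rw [map_add]; noncomm_ring
      _ = 0 := by rw [h₁, h₂, add_zero]
  | single i m =>
    induction y using Finsupp.induction_linear with
    | zero => simp
    | add y₁ y₂ h₁ h₂ =>
      rw [map_add, mul_add, add_mul, add_add_add_comm, h₁, h₂, add_zero]
    | single j n =>
      rw [toExtPoly_single, toExtPoly_single, Polynomial.monomial_mul_monomial,
        Polynomial.monomial_mul_monomial, add_comm j i, ← map_add,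
        ExteriorAlgebra.ι_add_mul_swap, map_zero]

theorem toExtPoly_mul_self (x : ℕ →₀ M₀) : toExtPoly x * toExtPoly x = 0 := by
  induction x using Finsupp.induction_linear with
  | zero => simp
  | add x₁ x₂ h₁ h₂ =>
    rw [map_add, mul_add, add_mul, add_mul, h₁, h₂, zero_add, add_zero, add_comm]
    exact toExtPoly_anticomm x₁ x₂
  | single i m =>
    rw [toExtPoly_single, Polynomial.monomial_mul_monomial, ExteriorAlgebra.ι_sq_zero, map_zero]

/-- The unique Hasse–Schmidt derivation (algebra homomorphism) `⋀ M₀ → (⋀ M₀)[w]` that extends a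
given `ℤ`-linear map `M₀ → M₀[w]`. -/
def hasseSchmidt (f : M₀ →ₗ[ℤ] (ℕ →₀ M₀)) : Ext →ₐ[ℤ] Polynomial Ext :=
  ExteriorAlgebra.lift ℤ ⟨toExtPoly ∘ₗ f, fun m => toExtPoly_mul_self (f m)⟩

/-- The map `bᵢ ↦ ∑_{j ≤ i} b_{i-j} wʲ` from `M₀` to `M₀[w]`. -/
def shiftMinus : M₀ →ₗ[ℤ] (ℕ →₀ M₀) :=
  Finsupp.linearCombination ℤ fun i =>
    ∑ j ∈ Finset.range (i + 1), Finsupp.single j (b (i - j))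

/-- The map `bᵢ ↦ bᵢ - b_{i-1} w` from `M₀` to `M₀[w]`, where `b₋₁ = 0`. -/
def shiftBarMinus : M₀ →ₗ[ℤ] (ℕ →₀ M₀) :=
  Finsupp.linearCombination ℤ fun i =>
    Finsupp.single 0 (b i) - (if i = 0 then 0 else Finsupp.single 1 (b (i - 1)))

/-- The Schubert derivation `σ₋(z)`, in the variable `w = z⁻¹`: the Hasse–Schmidt derivation with
`σ₋(z) bᵢ = ∑_{j ≤ i} b_{i-j} z⁻ʲ`. -/
def sigmaMinus : Ext →ₐ[ℤ] Polynomial Ext := hasseSchmidt shiftMinus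

/-- The Schubert derivation `σ̄₋(z)`, in the variable `w = z⁻¹`: the Hasse–Schmidt derivation with
`σ̄₋(z) bᵢ = bᵢ - b_{i-1} z⁻¹`. It is the inverse of `σ₋(z)`: see
`sigmaBarMinus_sigmaMinus` and `sigmaMinus_sigmaBarMinus`. -/
def sigmaBarMinus : Ext →ₐ[ℤ] Polynomial Ext := hasseSchmidt shiftBarMinus

/-- The `w`-linear extension of `D : ⋀ M₀ → (⋀ M₀)[w]` to `(⋀ M₀)[w]`. -/
def extendW (D : Ext →ₐ[ℤ] Polynomial Ext) : Polynomial Ext →+* Polynomial Ext :=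
  Polynomial.eval₂RingHom' (D : Ext →+* Polynomial Ext) Polynomial.X
    fun _ => (Polynomial.commute_X _).symm

theorem extendW_C (D : Ext →ₐ[ℤ] Polynomial Ext) (x : Ext) :
    extendW D (Polynomial.C x) = D x := by
  simp [extendW, Polynomial.eval₂RingHom']

theorem extendW_X (D : Ext →ₐ[ℤ] Polynomial Ext) : extendW D Polynomial.X = Polynomial.X := by
  simp [extendW, Polynomial.eval₂RingHom']

theorem sigmaMinus_b_zero :
    sigmaMinus (ExteriorAlgebra.ι ℤ (b 0)) = Polynomial.C (ExteriorAlgebra.ι ℤ (b 0)) := by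
  simp [sigmaMinus, hasseSchmidt, shiftMinus, b, toExtPoly_single]

theorem sigmaMinus_b_succ (i : ℕ) :
    sigmaMinus (ExteriorAlgebra.ι ℤ (b (i + 1))) = Polynomial.C (ExteriorAlgebra.ι ℤ (b (i + 1)))
      + Polynomial.X * sigmaMinus (ExteriorAlgebra.ι ℤ (b i)) := by
  simp only [sigmaMinus, hasseSchmidt, shiftMinus, ExteriorAlgebra.lift_ι_apply,
    LinearMap.comp_apply]
  rw [show b (i + 1) = Finsupp.single (i + 1) 1 from rfl, show b i = Finsupp.single i 1 from rfl,
    Finsupp.linearCombination_single, Finsupp.linearCombination_single, one_smul, one_smul,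
    Finset.sum_range_succ', map_add, map_sum, map_sum, Finset.mul_sum, add_comm]
  congr 1
  · simp [toExtPoly_single, b]
  · refine Finset.sum_congr rfl fun j _ => ?_
    rw [toExtPoly_single, toExtPoly_single, Polynomial.X_mul_monomial, Nat.add_sub_add_right]

theorem sigmaBarMinus_b_zero :
    sigmaBarMinus (ExteriorAlgebra.ι ℤ (b 0)) = Polynomial.C (ExteriorAlgebra.ι ℤ (b 0)) := by
  simp [sigmaBarMinus, hasseSchmidt, shiftBarMinus, b, toExtPoly_single]

theorem sigmaBarMinus_b_succ (i : ℕ) :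
    sigmaBarMinus (ExteriorAlgebra.ι ℤ (b (i + 1))) =
      Polynomial.C (ExteriorAlgebra.ι ℤ (b (i + 1)))
        - Polynomial.X * Polynomial.C (ExteriorAlgebra.ι ℤ (b i)) := by
  simp [sigmaBarMinus, hasseSchmidt, shiftBarMinus, b, toExtPoly_single,
    Polynomial.X_mul_C, Polynomial.C_mul_X_eq_monomial]

theorem extendW_comp_eq_C (D D' : Ext →ₐ[ℤ] Polynomial Ext)
    (hD : ∀ i, extendW D (D' (ExteriorAlgebra.ι ℤ (b i)))
      = Polynomial.C (ExteriorAlgebra.ι ℤ (b i))) (x : Ext) :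
    extendW D (D' x) = Polynomial.C x := by
  have key : ((extendW D).toIntAlgHom).comp D' =
      (Polynomial.C : Ext →+* Polynomial Ext).toIntAlgHom := by
    apply ExteriorAlgebra.hom_ext
    apply Finsupp.lhom_ext
    intro i n
    have hn : (Finsupp.single i n : M₀) = n • b i := by simp [b]
    rw [hn, map_smul, map_smul]
    congr 1
    exact hD i
  exact DFunLike.congr_fun key x

theorem sigmaBarMinus_sigmaMinus (x : Ext) :
    extendW sigmaBarMinus (sigmaMinus x) = Polynomial.C x := by
  refine extendW_comp_eq_C _ _ (fun i => ?_) x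
  induction i with
  | zero => rw [sigmaMinus_b_zero, extendW_C, sigmaBarMinus_b_zero]
  | succ i ih =>
    rw [sigmaMinus_b_succ, map_add, map_mul, ih, extendW_C, extendW_X, sigmaBarMinus_b_succ,
      sub_add_cancel]

theorem sigmaMinus_sigmaBarMinus (x : Ext) :
    extendW sigmaMinus (sigmaBarMinus x) = Polynomial.C x := by
  refine extendW_comp_eq_C _ _ (fun i => ?_) x
  cases i with
  | zero => rw [sigmaBarMinus_b_zero, extendW_C, sigmaMinus_b_zero]
  | succ i =>
    rw [sigmaBarMinus_b_succ, map_sub, map_mul, extendW_C, extendW_C, extendW_X,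
      sigmaMinus_b_succ, add_sub_cancel_right]

theorem toExtPoly_coeff (x : ℕ →₀ M₀) (k : ℕ) :
    (toExtPoly x).coeff k = ExteriorAlgebra.ι ℤ (x k) := by
  induction x using Finsupp.induction_linear with
  | zero => simp
  | add x y hx hy => simp [hx, hy]
  | single i m =>
    rw [toExtPoly_single, Polynomial.coeff_monomial, Finsupp.single_apply]
    split_ifs <;> simp

/-- The coefficients of a Hasse–Schmidt derivation that extends a map `M₀ → M₀[w]` preserve each
exterior power. -/
theorem hasseSchmidt_coeff_mem (f : M₀ →ₗ[ℤ] (ℕ →₀ M₀)) (r : ℕ) (x : Ext) (hx : x ∈ ⋀[ℤ]^r M₀)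
    (k : ℕ) : (hasseSchmidt f x).coeff k ∈ ⋀[ℤ]^r M₀ := by
  induction hx using Submodule.pow_induction_on_left' generalizing k with
  | algebraMap a =>
    rw [AlgHom.commutes, ExteriorAlgebra.exteriorPower, pow_zero, Polynomial.algebraMap_apply, Polynomial.coeff_C]
    split_ifs
    · exact Submodule.mem_one.2 ⟨a, rfl⟩
    · exact Submodule.zero_mem _
  | add x y i hx hy ihx ihy =>
    rw [map_add, Polynomial.coeff_add]
    exact Submodule.add_mem _ (ihx k) (ihy k)
  | mem_mul m hm i x hx ih =>
    obtain ⟨v, rfl⟩ := hm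
    rw [map_mul, Polynomial.coeff_mul, ExteriorAlgebra.exteriorPower, Nat.succ_eq_add_one, pow_succ']
    refine Submodule.sum_mem _ fun c _ => Submodule.mul_mem_mul ?_ (ih _)
    rw [hasseSchmidt, ExteriorAlgebra.lift_ι_apply]
    exact ⟨_, (toExtPoly_coeff _ _).symm⟩

/-- The coefficient of `wᵏ` of a Hasse–Schmidt derivation, as a self-map of `⋀ʳ M₀`. -/
def hsCoeff (f : M₀ →ₗ[ℤ] (ℕ →₀ M₀)) (r k : ℕ) (m : ⋀[ℤ]^r M₀) : ⋀[ℤ]^r M₀ :=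
  ⟨(hasseSchmidt f m).coeff k, hasseSchmidt_coeff_mem f r m m.2 k⟩

/-! ### Partitions and the bases of the exterior powers -/

/-- A partition: a non-increasing sequence `λ₁ ≥ λ₂ ≥ …` of natural numbers with finitely many
non-zero terms. The part `λ_{i+1}` is `l.1 i`. -/
abbrev Part : Type := {l : ℕ →₀ ℕ // Antitone l}

/-- The length of a partition: the number of its non-zero parts. -/
def Part.length (l : Part) : ℕ := l.1.support.card

/-- Partitions of length at most `r`. -/
abbrev PartLE (r : ℕ) : Type := {l : Part // l.length ≤ r}

/-- `[b]ʳ_λ = b_{λ_r} ∧ b_{1+λ_{r-1}} ∧ ⋯ ∧ b_{r-1+λ_1}` in `⋀ʳ M₀`. -/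
def wedge (r : ℕ) (l : Part) : ⋀[ℤ]^r M₀ :=
  exteriorPower.ιMulti ℤ r fun i : Fin r => b (i + l.1 (r - 1 - i))

/-- `(a_λ) ↦ ∑ a_λ [b]ʳ_λ`, where `λ` runs over the partitions of length at most `r`. It is
bijective since the `[b]ʳ_λ` form a basis of `⋀ʳ M₀`. -/
def wedgeSum (r : ℕ) : (PartLE r →₀ ℤ) →ₗ[ℤ] ⋀[ℤ]^r M₀ :=
  Finsupp.linearCombination ℤ fun l => wedge r l.1

/-- The Grassmann cone `𝒢_r`: the set of all `m₁ ∧ ⋯ ∧ m_r` in `⋀ʳ M₀`. -/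
def grassmannCone (r : ℕ) : Set (⋀[ℤ]^r M₀) :=
  Set.range (exteriorPower.ιMulti ℤ r : M₀ [⋀^Fin r]→ₗ[ℤ] ⋀[ℤ]^r M₀)

/-! ### Polynomial rings and Schur determinants -/

section Schur

variable {R : Type} [CommRing R]

/-- `E(z) = ∑ (-1)ⁱ eᵢ zⁱ`. -/
def seriesE (e : ℕ → R) : PowerSeries R := PowerSeries.mk fun n => (-1) ^ n * e n

/-- `1 / E(z)`, for a sequence with `e₀ = 1`. -/
def seriesH (e : ℕ → R) : PowerSeries R := PowerSeries.invOfUnit (seriesE e) 1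

/-- The bilateral sequence `(h_j)`: the coefficients of `1 / E(z)`, with `h_j = 0` for `j < 0`. -/
def h (e : ℕ → R) (j : ℤ) : R := if j < 0 then 0 else PowerSeries.coeff j.toNat (seriesH e)

/-- The Schur determinant `det (h_{λ_j - j + i})_{1 ≤ i, j ≤ r}`. -/
def schur (e : ℕ → R) (r : ℕ) (l : Part) : R :=
  Matrix.det (Matrix.of fun i j : Fin r => h e ((l.1 j : ℤ) - (j : ℤ) + (i : ℤ)))

end Schur

/-- `B_r = ℤ[e₁, …, e_r]`; the variable `X i` is `e_{i+1}`. -/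
abbrev B (r : ℕ) : Type := MvPolynomial (Fin r) ℤ

/-- `B_∞ = ℤ[e₁, e₂, …]`; the variable `X i` is `e_{i+1}`. -/
abbrev BInf : Type := MvPolynomial ℕ ℤ

/-- The sequence `1, e₁, …, e_r, 0, 0, …` in `B_r`. -/
def e (r : ℕ) : ℕ → B r
  | 0 => 1
  | n + 1 => if hn : n < r then MvPolynomial.X ⟨n, hn⟩ else 0

/-- The sequence `1, e₁, e₂, …` in `B_∞`. -/
def eInf : ℕ → BInf
  | 0 => 1
  | n + 1 => MvPolynomial.X n

/-- The inclusion `B_r ⊆ B_∞`. -/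
def inclB (r : ℕ) : B r →ₐ[ℤ] BInf := MvPolynomial.rename Fin.val

/-- `(a_λ) ↦ ∑ a_λ Δ_λ(H_r)`, where `λ` runs over the partitions of length at most `r`. It is
bijective since the `Δ_λ(H_r)` form a basis of `B_r`. -/
def schurSum (r : ℕ) : (PartLE r →₀ ℤ) →ₗ[ℤ] B r :=
  Finsupp.linearCombination ℤ fun l => schur (e r) r l.1

/-- The isomorphism `φ_r : B_r → ⋀ʳ M₀` with `Δ_λ(H_r) ↦ [b]ʳ_λ`. -/
def phi (r : ℕ) (p : B r) : ⋀[ℤ]^r M₀ := wedgeSum r (Function.invFun (schurSum r) p)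

/-- The Schur determinant `Δ_λ(H_∞)`. -/
def schurInf (l : Part) : BInf := schur eInf l.length l

/-- `(a_λ) ↦ ∑ a_λ Δ_λ(H_∞)`, where `λ` runs over all partitions. It is bijective since the
`Δ_λ(H_∞)` form a basis of `B_∞`. -/
def schurSumInf : (Part →₀ ℤ) →ₗ[ℤ] BInf := Finsupp.linearCombination ℤ schurInf

/-- The map `⋀ʳ M₀ → B_∞` with `[b]ʳ_λ ↦ Δ_λ(H_∞)` for all `λ` of length at most `r`. -/
def toBInf (r : ℕ) (m : ⋀[ℤ]^r M₀) : BInf :=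
  schurSumInf ((Function.invFun (wedgeSum r) m).mapDomain Subtype.val)

/-! ### The operators on `B_∞` and the residue -/

/-- A Hasse–Schmidt derivation `D(z) = ∑ D_k wᵏ`, `w = z⁻¹`, of `⋀ M₀` as a map
`B_∞ → B_∞[w]`: the additive map that sends `Δ_λ(H_∞)` to `∑_μ a_μ(w) Δ_μ(H_∞)`, where
`D(z) [b]ʳ_λ = ∑_μ a_μ(w) [b]ʳ_μ`. Here `r` is the length of `λ`; for `σ₋(z)` and `σ̄₋(z)` each
larger `r` gives the same `a_μ`. -/
def onBInf (f : M₀ →ₗ[ℤ] (ℕ →₀ M₀)) (p : BInf) : Polynomial BInf :=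
  (Function.invFun schurSumInf p).sum fun l a =>
    a • ∑ k ∈ (hasseSchmidt f (wedge l.length l)).support,
      Polynomial.monomial k (toBInf l.length (hsCoeff f l.length k (wedge l.length l)))

/-- `σ₋(z) : B_∞ → B_∞[z⁻¹]`, in the variable `w = z⁻¹`. -/
def sigmaMinusB (p : BInf) : Polynomial BInf := onBInf shiftMinus p

/-- `σ̄₋(z) : B_∞ → B_∞[z⁻¹]`, in the variable `w = z⁻¹`. -/
def sigmaBarMinusB (p : BInf) : Polynomial BInf := onBInf shiftBarMinus p

/-- The inclusion `B_∞[z⁻¹] → B_∞((z))`, with `w ↦ z⁻¹`. -/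
def toLaurent : Polynomial BInf →ₐ[BInf] LaurentSeries BInf :=
  Polynomial.aeval (HahnSeries.single (-1 : ℤ) (1 : BInf))

/-- `E_∞(z) σ₋(z) p` in `B_∞((z))`. -/
def gammaStar (p : BInf) : LaurentSeries BInf :=
  HahnSeries.ofPowerSeries ℤ BInf (seriesE eInf) * toLaurent (sigmaMinusB p)

/-- `E_∞(z)⁻¹ σ̄₋(z) p` in `B_∞((z))`. -/
def gamma (p : BInf) : LaurentSeries BInf :=
  HahnSeries.ofPowerSeries ℤ BInf (seriesH eInf) * toLaurent (sigmaBarMinusB p)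

/-- For `f = ∑ fᵢ zⁱ` and `g = ∑ gⱼ zʲ`, the series `f ⊗ g = ∑ₙ (∑_{i+j=n} fᵢ ⊗ gⱼ) zⁿ` in
`(B_∞ ⊗ B_∞)((z))`. -/
def tensorSeries (f g : LaurentSeries BInf) : LaurentSeries (BInf ⊗[ℤ] BInf) :=
  f.map (Algebra.TensorProduct.includeLeft : BInf →ₐ[ℤ] BInf ⊗[ℤ] BInf) *
    g.map (Algebra.TensorProduct.includeRight : BInf →ₐ[ℤ] BInf ⊗[ℤ] BInf)

/-- `Res_z`: the coefficient of `z⁻¹`. -/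
def residue {R : Type} [CommRing R] (f : LaurentSeries R) : R := f.coeff (-1)

/-- `p ∈ B_∞` corresponds to an element of the Grassmann cone `𝒢_∞`: for all sufficiently large
`s`, the polynomial `p` lies in `B_s` and `φ_s(p) ∈ 𝒢_s`. -/
def CorrespondsToCone (p : BInf) : Prop :=
  ∃ r : ℕ, ∀ s ≥ r, ∃ q : B s, inclB s q = p ∧ phi s q ∈ grassmannCone s

end GrassmannKP

end

open scoped TensorProduct

noncomputable section

namespace GrassmannKP

/-! For large s write p as the image of some x in ⋀ˢ M₀ under the form `hForm eInf`, which sends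
b_{i₀} ∧ ⋯ ∧ b_{i_{s-1}} to det(h_{i_k - l}), hence [b]ˢ_λ to Δ_λ for every s ≥ ℓ(λ). The theorem
then says that the residue vanishes exactly when x is decomposable.

The two series are generating functions of elementary operators on the exterior algebra. Up to sign,
the coefficients of E(z)⁻¹ σ̄₋(z) p are the images of bₙ ∧ x (`coeff_gamma`) and those of E(z) σ₋(z)
p are the images of the contractions βₙ ⌟ x (`coeff_gammaStar`), where βₙ are the coordinate forms.
Both follow from Laplace expansions: passing to σ₋ or σ̄₋ multiplies E(z) by (1 - wz) or its
inverse, which amounts to column operations on the determinants. So the residue is minus the image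
of the Plücker tensor ∑ (βₙ ⌟ x) ⊗ (bₙ ∧ x) (`residue_eq`).

On each exterior power `hForm eInf` is injective: specialising the eₙ to elementary symmetric
polynomials and multiplying by a fixed determinant turns it into alternants, which are linearly
independent. All groups involved are flat, so the residue vanishes iff the Plücker tensor does
(`tensor_hForm_plucker_eq_zero`).

Over a principal ideal domain of characteristic zero a vanishing Plücker tensor forces
decomposability. It yields u with u ∧ x = 0 and a form d with d(u) = 1, so x = u ∧ (d ⌟ x); since d
⌟ x satisfies the same relation, induction on the degree applies (`mem_grassmannCone_iff`). -/

/-- The exterior algebra of the free module `K^(ℕ)`. -/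
abbrev Λ (K : Type*) [CommRing K] : Type _ := ExteriorAlgebra K (ℕ →₀ K)

variable {K : Type*} [CommRing K]

/-! ### Contractions of the exterior algebra and decomposability -/

instance : Module.Free K (Λ K) :=
  Module.Free.of_basis (Finsupp.basisSingleOne (R := K) (ι := ℕ)).ExteriorAlgebra

/-- The contraction of the exterior algebra by a linear form. -/
def contract (d : (ℕ →₀ K) →ₗ[K] K) : Λ K →ₗ[K] Λ K :=
  CliffordAlgebra.contractLeft (Q := (0 : QuadraticForm K (ℕ →₀ K))) d

theorem contract_ι_mul (d : (ℕ →₀ K) →ₗ[K] K) (v : ℕ →₀ K) (x : Λ K) :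
    contract d (ExteriorAlgebra.ι K v * x) = d v • x - ExteriorAlgebra.ι K v * contract d x :=
  CliffordAlgebra.contractLeft_ι_mul d v x

theorem contract_algebraMap (d : (ℕ →₀ K) →ₗ[K] K) (c : K) :
    contract d (algebraMap K (Λ K) c) = 0 :=
  CliffordAlgebra.contractLeft_algebraMap ..

theorem contract_contract (d : (ℕ →₀ K) →ₗ[K] K) (x : Λ K) : contract d (contract d x) = 0 :=
  CliffordAlgebra.contractLeft_contractLeft d x

theorem contract_comm (d d' : (ℕ →₀ K) →ₗ[K] K) (x : Λ K) :
    contract d (contract d' x) = -contract d' (contract d x) :=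
  CliffordAlgebra.contractLeft_comm d d' x

theorem contract_induction {P : Λ K → Prop} (algebraMap : ∀ c : K, P (algebraMap K (Λ K) c))
    (add : ∀ x y, P x → P y → P (x + y))
    (ι_mul : ∀ x v, P x → P (ExteriorAlgebra.ι K v * x)) (x : Λ K) : P x :=
  CliffordAlgebra.left_induction (0 : QuadraticForm K (ℕ →₀ K)) algebraMap add ι_mul x

/-- Only finitely many basis vectors occur in a given x, so sums over all βᵢ ⌟ x make sense. -/
theorem contract_lapply_finite_support (x : Λ K) :
    (Function.support fun i => contract (Finsupp.lapply i) x).Finite := by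
  induction x using contract_induction with
  | algebraMap c => simp only [contract_algebraMap]; simp
  | add x y hx hy =>
    refine (hx.union hy).subset fun i hi => ?_
    by_contra! h
    simp only [Set.mem_union, Function.mem_support, not_or, not_not] at h
    exact hi (by simp [h.1, h.2])
  | ι_mul x v hx =>
    refine (hx.union v.support.finite_toSet).subset fun i hi => ?_
    by_contra! h
    simp only [Set.mem_union, Function.mem_support, not_or, not_not, Finset.mem_coe,
      Finsupp.mem_support_iff] at h
    exact hi (by simp [contract_ι_mul, h.1, h.2])

/-- The family of the contractions by all coordinate forms. -/
def contractions : Λ K →ₗ[K] (ℕ →₀ Λ K) where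
  toFun x := Finsupp.ofSupportFinite _ (contract_lapply_finite_support x)
  map_add' x y := by ext1 i; exact map_add (contract _) x y
  map_smul' c x := by ext1 i; exact map_smul (contract _) c x

theorem contractions_apply (x : Λ K) (i : ℕ) :
    contractions x i = contract (Finsupp.lapply i) x := rfl

/-! ### Sums over dual bases. -/

variable {N N' : Type*} [AddCommGroup N] [Module K N] [AddCommGroup N'] [Module K N']

/-- `∑ᵢ f (βᵢ ⌟ x) bᵢ`, where `βᵢ` are the coordinate forms. -/
def contractSum (f : Λ K →ₗ[K] (ℕ →₀ K) →ₗ[K] N) : Λ K →ₗ[K] N :=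
  Finsupp.lsum K (fun i => f.flip (.single i 1)) ∘ₗ contractions

theorem contractSum_apply (f : Λ K →ₗ[K] (ℕ →₀ K) →ₗ[K] N) (x : Λ K) :
    contractSum f x = ∑ i ∈ (contractions x).support, f (contractions x i) (.single i 1) := by
  simp [contractSum, Finsupp.sum]

theorem contractSum_algebraMap (f : Λ K →ₗ[K] (ℕ →₀ K) →ₗ[K] N) (c : K) :
    contractSum f (algebraMap K (Λ K) c) = 0 := by
  have : contractions (algebraMap K (Λ K) c) = 0 := by
    ext1 i; exact contract_algebraMap _ _
  rw [contractSum, LinearMap.comp_apply, this, map_zero]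

/-- Leibniz rule for each βᵢ; the first terms recombine through ∑ βᵢ(v) bᵢ = v. -/
theorem contractSum_ι_mul (f : Λ K →ₗ[K] (ℕ →₀ K) →ₗ[K] N) (v : ℕ →₀ K) (x : Λ K) :
    contractSum f (ExteriorAlgebra.ι K v * x) =
      f x v - contractSum (f ∘ₗ LinearMap.mulLeft K (ExteriorAlgebra.ι K v)) x := by
  have h₁ : contractions (ExteriorAlgebra.ι K v * x) =
      Finsupp.mapRange.linearMap (LinearMap.toSpanSingleton K (Λ K) x) v -
        Finsupp.mapRange.linearMap (LinearMap.mulLeft K (ExteriorAlgebra.ι K v))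
          (contractions x) := by
    ext1 i
    simp [contractions_apply, contract_ι_mul]
  have h₂ : ∀ v : (ℕ →₀ K), Finsupp.lsum K (fun i => f.flip (.single i 1))
      (Finsupp.mapRange.linearMap (LinearMap.toSpanSingleton K (Λ K) x) v) = f x v := by
    intro v
    induction v using Finsupp.induction_linear with
    | zero => simp
    | add u v hu hv => simp only [map_add, hu, hv]
    | single i c =>
      rw [Finsupp.mapRange.linearMap_apply, Finsupp.mapRange_single, Finsupp.lsum_single]
      have : (Finsupp.single i c : (ℕ →₀ K)) = c • .single i 1 := by simp
      simp only [this, map_smul, LinearMap.toSpanSingleton_apply, LinearMap.flip_apply]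
  have h₃ : ∀ y : ℕ →₀ Λ K, Finsupp.lsum K (fun i => f.flip (.single i 1))
      (Finsupp.mapRange.linearMap (LinearMap.mulLeft K (ExteriorAlgebra.ι K v)) y) =
      Finsupp.lsum K (fun i =>
        (f ∘ₗ LinearMap.mulLeft K (ExteriorAlgebra.ι K v)).flip (.single i 1)) y := by
    intro y
    induction y using Finsupp.induction_linear with
    | zero => simp
    | add u v hu hv => simp only [map_add, hu, hv]
    | single i c =>
      rw [Finsupp.mapRange.linearMap_apply, Finsupp.mapRange_single, Finsupp.lsum_single,
        Finsupp.lsum_single]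
      rfl
  rw [contractSum, LinearMap.comp_apply, h₁, map_sub, h₂, h₃]
  rfl

theorem contractSum_congr {f g : Λ K →ₗ[K] (ℕ →₀ K) →ₗ[K] N} {x : Λ K}
    (h : ∀ y i, f y (.single i 1) = g y (.single i 1)) : contractSum f x = contractSum g x := by
  simp only [contractSum_apply, h]

theorem map_contractSum (L : N →ₗ[K] N') (f : Λ K →ₗ[K] (ℕ →₀ K) →ₗ[K] N) (x : Λ K) :
    L (contractSum f x) = contractSum (f.compr₂ L) x := by
  simp [contractSum_apply]

/-- This is the expansion d = ∑ d(bᵢ) βᵢ, which is finite once evaluated on x. -/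
theorem contractSum_smul (d : (ℕ →₀ K) →ₗ[K] K) (x : Λ K) :
    contractSum ((LinearMap.lsmul K (Λ K) ∘ₗ d).flip) x = contract d x := by
  induction x using contract_induction with
  | algebraMap c => rw [contractSum_algebraMap, contract_algebraMap]
  | add x y hx hy => rw [map_add, hx, hy, map_add]
  | ι_mul x v hx =>
    rw [contractSum_ι_mul, contract_ι_mul, ← hx,
      show ∀ y, ExteriorAlgebra.ι K v * y = LinearMap.mulLeft K (ExteriorAlgebra.ι K v) y from
        fun _ => rfl, map_contractSum]
    congr 1
    refine contractSum_congr fun y i => ?_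
    simp

theorem contractSum_contract (f : Λ K →ₗ[K] (ℕ →₀ K) →ₗ[K] N) (d : (ℕ →₀ K) →ₗ[K] K) (x : Λ K) :
    contractSum f (contract d x) = -contractSum (f ∘ₗ contract d) x := by
  have h : contractions (contract d x) = -Finsupp.mapRange.linearMap (contract d)
      (contractions x) := by
    ext1 i
    exact contract_comm _ _ _
  have h₃ : ∀ y : ℕ →₀ Λ K, Finsupp.lsum K (fun i => f.flip (.single i 1))
      (Finsupp.mapRange.linearMap (contract d) y) =
      Finsupp.lsum K (fun i => (f ∘ₗ contract d).flip (.single i 1)) y := by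
    intro y
    induction y using Finsupp.induction_linear with
    | zero => simp
    | add u v hu hv => simp only [map_add, hu, hv]
    | single i c =>
      rw [Finsupp.mapRange.linearMap_apply, Finsupp.mapRange_single, Finsupp.lsum_single,
        Finsupp.lsum_single]
      rfl
  rw [contractSum, LinearMap.comp_apply, h, map_neg, h₃]
  rfl

/-- Iterating the Leibniz rule removes one factor at a time; the basis disappears from the result.
-/
theorem contractSum_ιMulti (f : Λ K →ₗ[K] (ℕ →₀ K) →ₗ[K] N) (r : ℕ) (m : Fin (r + 1) → (ℕ →₀ K)) :
    contractSum f (ExteriorAlgebra.ιMulti K (r + 1) m) =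
      ∑ k : Fin (r + 1), (-1 : K) ^ (k : ℕ) •
        f (ExteriorAlgebra.ιMulti K r fun j => m (k.succAbove j)) (m k) := by
  induction r generalizing f with
  | zero =>
    rw [ExteriorAlgebra.ιMulti_succ_apply, contractSum_ι_mul]
    rw [ExteriorAlgebra.ιMulti_zero_apply, ← map_one (algebraMap K (Λ K)), contractSum_algebraMap]
    simp
  | succ r ih =>
    rw [ExteriorAlgebra.ιMulti_succ_apply, contractSum_ι_mul, ih, Fin.sum_univ_succ (n := r + 1),
      sub_eq_add_neg, ← Finset.sum_neg_distrib]
    congr 1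
    · simp [Matrix.vecTail, Function.comp_def]
    · refine Finset.sum_congr rfl fun k _ => ?_
      rw [Fin.val_succ, pow_succ, mul_neg_one, neg_smul, ExteriorAlgebra.ιMulti_succ_apply]
      simp [Matrix.vecTail, Function.comp_def]

/-! ### Plücker relations and decomposability. -/

/-- `∑ᵢ (βᵢ ⌟ x) ⊗ (bᵢ ∧ x)`. -/
def plucker (x : Λ K) : Λ K ⊗[K] Λ K :=
  contractSum ((TensorProduct.mk K (Λ K) (Λ K)).compl₂
    (LinearMap.mulRight K x ∘ₗ ExteriorAlgebra.ι K)) x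

theorem plucker_eq_sum (x : Λ K) : plucker x = ∑ i ∈ (contractions x).support,
    contractions x i ⊗ₜ[K] (ExteriorAlgebra.ι K (.single i 1) * x) := by
  simp [plucker, contractSum_apply]

theorem ι_mul_ιMulti_self {r : ℕ} (m : Fin r → (ℕ →₀ K)) (k : Fin r) :
    ExteriorAlgebra.ι K (m k) * ExteriorAlgebra.ιMulti K r m = 0 := by
  rw [ExteriorAlgebra.ιMulti_apply]
  exact ExteriorAlgebra.ι_mul_prod_list m k

/-- Each term of the expansion contains m_k ∧ m₀ ∧ ⋯ ∧ m_r, which repeats a factor. -/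
theorem plucker_ιMulti (r : ℕ) (m : Fin (r + 1) → (ℕ →₀ K)) :
    plucker (ExteriorAlgebra.ιMulti K (r + 1) m) = 0 := by
  rw [plucker, contractSum_ιMulti]
  refine Finset.sum_eq_zero fun k _ => ?_
  have := ι_mul_ιMulti_self m k
  simp only [LinearMap.compl₂_apply, LinearMap.comp_apply, LinearMap.mulRight_apply, this,
    map_zero, smul_zero]

/-- Apply d ⌟ to both tensor factors of the relation for x. By the Leibniz rule the second factor
becomes d(bᵢ) x - bᵢ ∧ (d ⌟ x). The first part sums to (d ⌟ d ⌟ x) ⊗ x = 0; the second is the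
relation for d ⌟ x up to sign. -/
theorem plucker_contract {x : Λ K} (hx : plucker x = 0) (d : (ℕ →₀ K) →ₗ[K] K) :
    plucker (contract d x) = 0 := by
  have h₁ := congrArg (TensorProduct.map (contract d) (contract d)) hx
  rw [map_zero, plucker, map_contractSum] at h₁
  have h₂ := congrArg ((TensorProduct.mk K (Λ K) (Λ K)).flip x ∘ₗ contract d)
    (contractSum_smul d x)
  rw [map_contractSum, LinearMap.comp_apply, contract_contract, map_zero] at h₂
  rw [plucker, contractSum_contract, neg_eq_zero, ← h₂,
    ← sub_zero (contractSum ((LinearMap.lsmul K _ ∘ₗ d).flip.compr₂ _) x), ← h₁]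
  simp only [contractSum_apply, ← Finset.sum_sub_distrib]
  refine Finset.sum_congr rfl fun i _ => ?_
  have := contract_ι_mul d (.single i 1) x
  simp [TensorProduct.tmul_sub, this]

/-- Euler's identity: ∑ bᵢ ∧ (βᵢ ⌟ ·) counts the degree. In characteristic zero it shows that a
non-zero x of positive degree has a non-zero contraction. -/
theorem contractSum_euler {r : ℕ} {x : Λ K} (hx : x ∈ ⋀[K]^r (ℕ →₀ K)) :
    contractSum ((LinearMap.mul K (Λ K) ∘ₗ ExteriorAlgebra.ι K).flip) x = (r : K) • x := by
  induction hx using Submodule.pow_induction_on_left' with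
  | algebraMap c => rw [contractSum_algebraMap, Nat.cast_zero, zero_smul]
  | add x y i hx hy ihx ihy => rw [map_add, ihx, ihy, smul_add]
  | mem_mul m hm i x hx ih =>
    obtain ⟨v, rfl⟩ := hm
    have h : contractSum ((LinearMap.mul K (Λ K) ∘ₗ ExteriorAlgebra.ι K).flip ∘ₗ
        LinearMap.mulLeft K (ExteriorAlgebra.ι K v)) x =
        -(ExteriorAlgebra.ι K v * ((i : K) • x)) := by
      rw [← ih, show ∀ y, ExteriorAlgebra.ι K v * y =
        LinearMap.mulLeft K (ExteriorAlgebra.ι K v) y from fun _ => rfl, map_contractSum,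
        contractSum_apply, contractSum_apply, ← Finset.sum_neg_distrib]
      refine Finset.sum_congr rfl fun j _ => ?_
      simp only [LinearMap.comp_apply, LinearMap.flip_apply, LinearMap.compr₂_apply,
        LinearMap.mulLeft_apply, LinearMap.mul_apply', ← mul_assoc]
      rw [← neg_mul, eq_neg_of_add_eq_zero_left (ExteriorAlgebra.ι_add_mul_swap (.single j 1) v)]
    rw [contractSum_ι_mul, h]
    rw [sub_neg_eq_add, mul_smul_comm]
    simp [add_smul, add_comm]

theorem contract_mem {r : ℕ} {x : Λ K} (hx : x ∈ ⋀[K]^(r + 1) (ℕ →₀ K)) (d : (ℕ →₀ K) →ₗ[K] K) :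
    contract d x ∈ ⋀[K]^r (ℕ →₀ K) := by
  rw [← ExteriorAlgebra.ιMulti_span_fixedDegree] at hx
  induction hx using Submodule.span_induction with
  | zero => simp
  | add x y _ _ hx hy => rw [map_add]; exact Submodule.add_mem _ hx hy
  | smul c x _ hx => rw [map_smul]; exact Submodule.smul_mem _ c hx
  | mem x hx =>
    obtain ⟨m, rfl⟩ := hx
    rw [← contractSum_smul, contractSum_ιMulti]
    refine Submodule.sum_mem _ fun k _ => Submodule.smul_mem _ _ ?_
    refine Submodule.smul_mem _ _ ?_
    exact ExteriorAlgebra.ιMulti_range K r ⟨_, rfl⟩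

variable [IsDomain K] [IsPrincipalIdealRing K]

/-- Over a principal ideal domain, a non-zero vector of a free module is a multiple of one
on which a linear form takes
the value `1`. -/
theorem exists_primitive {v : (ℕ →₀ K)} (hv : v ≠ 0) :
    ∃ (c : K) (u : ℕ →₀ K) (d : (ℕ →₀ K) →ₗ[K] K), c ≠ 0 ∧ v = c • u ∧ d u = 1 := by
  -- The values of all linear forms at v are an ideal; its generator c is the content of v.
  let I : Submodule K K := LinearMap.range (LinearMap.applyₗ (R := K) (M₂ := K) v)
  obtain ⟨c, hc⟩ := (IsPrincipalIdealRing.principal I).principal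
  have hmem : ∀ d : (ℕ →₀ K) →ₗ[K] K, c ∣ d v := fun d => by
    rw [← Ideal.mem_span_singleton, Ideal.span, ← hc]
    exact ⟨d, rfl⟩
  obtain ⟨d, hd⟩ : c ∈ I := hc ▸ Submodule.mem_span_singleton_self c
  replace hd : d v = c := hd
  have hc0 : c ≠ 0 := by
    rintro rfl
    exact hv (Finsupp.ext fun i => zero_dvd_iff.1 (hmem (Finsupp.lapply i)))
  choose q hq using fun i => hmem (Finsupp.lapply i)
  have hvu : v = c • (⟨v.support, q, fun i => by
      rw [Finsupp.mem_support_iff, show v i = c * q i from hq i, mul_ne_zero_iff_left hc0]⟩ :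
      ℕ →₀ K) := Finsupp.ext hq
  refine ⟨c, _, d, hc0, hvu, ?_⟩
  rw [hvu, map_smul, smul_eq_mul] at hd
  exact mul_left_cancel₀ hc0 (hd.trans (mul_one c).symm)

variable [CharZero K]

theorem exists_vector_of_plucker {r : ℕ} {x : Λ K} (hx : x ∈ ⋀[K]^(r + 1) (ℕ →₀ K))
    (hp : plucker x = 0) (h0 : x ≠ 0) :
    ∃ (u : ℕ →₀ K) (d : (ℕ →₀ K) →ₗ[K] K), d u = 1 ∧ ExteriorAlgebra.ι K u * x = 0 := by
  obtain ⟨i, hi⟩ : ∃ i, contractions x i ≠ 0 := by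
    by_contra! h
    have h₁ := contractSum_euler hx
    rw [contractSum_apply, Finset.sum_eq_zero (fun i _ => by rw [h i, map_zero]; rfl)] at h₁
    exact (smul_ne_zero (by exact_mod_cast r.succ_ne_zero) h0) h₁.symm
  obtain ⟨f, hf⟩ := Module.Projective.exists_dual_ne_zero K hi
  -- Applying f to the first factor of the Plücker tensor gives v ∧ x = 0, and the i-th coordinate
  -- of v is f(βᵢ ⌟ x) ≠ 0.
  let v : (ℕ →₀ K) := contractSum (LinearMap.lsmul K (ℕ →₀ K) ∘ₗ f) x
  have hv : v ≠ 0 := by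
    intro hv
    apply hf
    have h₁ := congrArg (Finsupp.lapply (R := K) i) hv
    rw [map_zero, map_contractSum] at h₁
    rw [contractions_apply, ← contractSum_smul, map_contractSum, ← h₁]
    refine contractSum_congr fun y j => ?_
    simp [Finsupp.single_apply, apply_ite f]
  have hvx : ExteriorAlgebra.ι K v * x = 0 := by
    have h₁ := congrArg (TensorProduct.lift (LinearMap.lsmul K (Λ K) ∘ₗ f)) hp
    rw [map_zero, plucker, map_contractSum] at h₁
    rw [← h₁]
    change (LinearMap.mulRight K x ∘ₗ ExteriorAlgebra.ι K) v = _
    rw [map_contractSum]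
    refine contractSum_congr fun y j => ?_
    simp [-Finsupp.smul_single]
  obtain ⟨c, u, d, hc, hvu, hd⟩ := exists_primitive hv
  refine ⟨u, d, hd, ?_⟩
  rw [hvu, map_smul, smul_mul_assoc] at hvx
  exact (smul_eq_zero.1 hvx).resolve_left hc

theorem exists_eq_smul_ιMulti_of_plucker {r : ℕ} {x : Λ K} (hx : x ∈ ⋀[K]^r (ℕ →₀ K))
    (hp : plucker x = 0) :
    ∃ (c : K) (m : Fin r → (ℕ →₀ K)), x = c • ExteriorAlgebra.ιMulti K r m := by
  induction r generalizing x with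
  | zero =>
    rw [ExteriorAlgebra.exteriorPower, pow_zero, Submodule.mem_one] at hx
    obtain ⟨c, rfl⟩ := hx
    refine ⟨c, Fin.elim0, ?_⟩
    rw [ExteriorAlgebra.ιMulti_zero_apply, Algebra.algebraMap_eq_smul_one]
  | succ r ih =>
    by_cases h0 : x = 0
    · exact ⟨0, 0, by simp [h0]⟩
    obtain ⟨u, d, hd, hu⟩ := exists_vector_of_plucker hx hp h0
    obtain ⟨c, m, hm⟩ := ih (contract_mem hx d) (plucker_contract hp d)
    refine ⟨c, Fin.cons u m, ?_⟩
    -- Contracting u ∧ x = 0 by d gives x = u ∧ (d ⌟ x), because d(u) = 1.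
    have h := congrArg (contract d) hu
    rw [contract_ι_mul, hd, one_smul, map_zero, sub_eq_zero] at h
    rw [ExteriorAlgebra.ιMulti_succ_apply, h, hm]
    simp [-zsmul_eq_mul, Matrix.vecTail, Function.comp_def]

/-- The scalar from `exists_eq_smul_ιMulti_of_plucker` is absorbed into the first factor, which
needs positive degree: in degree 0 every scalar satisfies the relation, but only 1 is in the cone.
-/
theorem mem_grassmannCone_iff {r : ℕ} (x : ⋀[ℤ]^(r + 1) M₀) :
    x ∈ grassmannCone (r + 1) ↔ plucker (x : Ext) = 0 := by
  constructor
  · rintro ⟨m, rfl⟩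
    exact plucker_ιMulti r m
  · intro h
    obtain ⟨c, m, hm⟩ := exists_eq_smul_ιMulti_of_plucker x.2 h
    refine ⟨Fin.cons (c • m 0) (Fin.tail m), Subtype.ext ?_⟩
    rw [exteriorPower.ιMulti_apply_coe, hm, ExteriorAlgebra.ιMulti_succ_apply,
      ExteriorAlgebra.ιMulti_succ_apply]
    simp [-zsmul_eq_mul, Matrix.vecTail, Function.comp_def, Fin.tail]

/-! ### Determinantal linear forms on the exterior algebra -/

section DetForm

variable {R : Type*} [CommRing R]

/-- The alternating map `(m₀, …) ↦ det (g_l m_k)`. -/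
def detAlternating (g : ℕ → M₀ →ₗ[ℤ] R) (r : ℕ) : M₀ [⋀^Fin r]→ₗ[ℤ] R where
  toMultilinearMap := ((Matrix.detRowAlternating
    (n := Fin r) (R := R)).toMultilinearMap.restrictScalars ℤ).compLinearMap
      fun _ => LinearMap.pi fun l : Fin r => g l
  map_eq_zero_of_eq' v i j h hij := by
    refine (Matrix.detRowAlternating (n := Fin r) (R := R)).map_eq_zero_of_eq _ ?_ hij
    ext l
    simp [h]

theorem detAlternating_apply (g : ℕ → M₀ →ₗ[ℤ] R) (r : ℕ) (m : Fin r → M₀) :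
    detAlternating g r m = (Matrix.of fun k l : Fin r => g l (m k)).det := rfl

/-- The linear map `m₀ ∧ ⋯ ∧ m_{r-1} ↦ det (g_l m_k)`. -/
def detForm (g : ℕ → M₀ →ₗ[ℤ] R) : Ext →ₗ[ℤ] R :=
  ExteriorAlgebra.liftAlternating (detAlternating g)

theorem detForm_ιMulti (g : ℕ → M₀ →ₗ[ℤ] R) (r : ℕ) (m : Fin r → M₀) :
    detForm g (ExteriorAlgebra.ιMulti ℤ r m) =
      (Matrix.of fun k l : Fin r => g l (m k)).det := by
  rw [detForm, ExteriorAlgebra.liftAlternating_apply_ιMulti, detAlternating_apply]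

theorem exteriorPower_ext {N : Type*} [AddCommGroup N] {L L' : Ext →ₗ[ℤ] N} {r : ℕ}
    (h : ∀ m : Fin r → M₀, L (ExteriorAlgebra.ιMulti ℤ r m) = L' (ExteriorAlgebra.ιMulti ℤ r m))
    {x : Ext} (hx : x ∈ ⋀[ℤ]^r M₀) : L x = L' x := by
  rw [← ExteriorAlgebra.ιMulti_span_fixedDegree] at hx
  exact LinearMap.eqOn_span (by rintro _ ⟨m, rfl⟩; exact h m) hx

theorem map_detForm {S F : Type*} [CommRing S] [FunLike F R S] [RingHomClass F R S] (f : F)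
    (g : ℕ → M₀ →ₗ[ℤ] R) (g' : ℕ → M₀ →ₗ[ℤ] S) (h : ∀ l i, f (g l (b i)) = g' l (b i)) (x : Ext) :
    f (detForm g x) = detForm g' x := by
  have hg : ∀ l m, f (g l m) = g' l m := by
    intro l m
    have : ((f : R →+* S) : R →+ S).toIntLinearMap ∘ₗ g l = g' l := by
      refine Finsupp.lhom_ext' fun i => LinearMap.ext_ring ?_
      exact h l i
    exact DFunLike.congr_fun this m
  have : ((f : R →+* S) : R →+ S).toIntLinearMap ∘ₗ detForm g = detForm g' := by
    rw [detForm, detForm, ← ExteriorAlgebra.liftAlternating_comp]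
    congr 1
    ext r m
    change f (detAlternating g r m) = detAlternating g' r m
    rw [detAlternating_apply, detAlternating_apply]
    rw [show f (Matrix.det _) = (f : R →+* S) (Matrix.det _) from rfl, RingHom.map_det]
    congr 1
    ext k l
    exact hg _ _
  exact DFunLike.congr_fun this x

/-- Adding to each column a multiple of the next one does not change a determinant. -/
theorem det_eq_of_forall_col_eq_smul_add_succ {n : ℕ}
    {A B : Matrix (Fin (n + 1)) (Fin (n + 1)) R} (c : R)
    (hlast : ∀ i, A i (Fin.last n) = B i (Fin.last n))
    (h : ∀ i (j : Fin n), A i j.castSucc = B i j.castSucc + c * A i j.succ) :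
    A.det = B.det := by
  have key : (A.submatrix Fin.revPerm Fin.revPerm).det =
      (B.submatrix Fin.revPerm Fin.revPerm).det := by
    refine Matrix.det_eq_of_forall_col_eq_smul_add_pred (fun _ => c) (fun i => ?_) fun i j => ?_
    · simpa using hlast i.rev
    · simpa [Fin.rev_succ, Fin.rev_castSucc] using h i.rev j.rev
  simpa using key

/-- Expansion along the last column. -/
theorem contractSum_detForm (g g' : ℕ → M₀ →ₗ[ℤ] R) {r : ℕ} (h : ∀ l < r, g' l = g l)
    {x : Ext} (hx : x ∈ ⋀[ℤ]^(r + 1) M₀) :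
    contractSum ((LinearMap.mul ℤ R).flip.compl₁₂ (detForm g) (g' r)) x =
      (-1) ^ r * detForm g' x := by
  refine exteriorPower_ext (L' := (LinearMap.mulLeft ℤ ((-1 : R) ^ r)) ∘ₗ detForm g')
    (fun m => ?_) hx
  rw [contractSum_ιMulti, LinearMap.comp_apply, LinearMap.mulLeft_apply, detForm_ιMulti,
    Matrix.det_succ_column _ (Fin.last r), Finset.mul_sum]
  refine Finset.sum_congr rfl fun k _ => ?_
  simp only [LinearMap.compl₁₂_apply, LinearMap.flip_apply, LinearMap.mul_apply',
    detForm_ιMulti, Fin.val_last, Matrix.of_apply]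
  have : (Matrix.of fun k l : Fin (r + 1) => g' l (m k)).submatrix k.succAbove
      (Fin.last r).succAbove = Matrix.of fun j l : Fin r => g l (m (k.succAbove j)) := by
    ext j l
    simp [h l l.2]
  rw [this, pow_add]
  have h1 : ((-1 : R) ^ r) * (-1) ^ r = 1 := by rw [← mul_pow]; simp
  linear_combination 
    (-((-1) ^ (k : ℕ) * (g' r (m k)) *
      (Matrix.of fun j l : Fin r => g l (m (k.succAbove j))).det)) * h1

/-- Expansion along the first row. -/
theorem detForm_ι_mul (g : ℕ → M₀ →ₗ[ℤ] R) (v : M₀) {r : ℕ} {x : Ext} (hx : x ∈ ⋀[ℤ]^r M₀) :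
    detForm g (ExteriorAlgebra.ι ℤ v * x) = ∑ l ∈ Finset.range (r + 1), (-1) ^ l * g l v *
      detForm (fun j => if j < l then g j else g (j + 1)) x := by
  have := exteriorPower_ext (L := detForm g ∘ₗ LinearMap.mulLeft ℤ (ExteriorAlgebra.ι ℤ v))
    (L' := ∑ l ∈ Finset.range (r + 1), (LinearMap.mulLeft ℤ ((-1) ^ l * g l v)) ∘ₗ
      detForm (fun j => if j < l then g j else g (j + 1)))
    (fun m => ?_) hx
  · simpa [mul_assoc] using this
  · have h : ExteriorAlgebra.ι ℤ v * ExteriorAlgebra.ιMulti ℤ r m =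
        ExteriorAlgebra.ιMulti ℤ (r + 1) (Fin.cons v m) := by
      rw [ExteriorAlgebra.ιMulti_succ_apply]
      simp [Matrix.vecTail, Function.comp_def]
    simp only [LinearMap.comp_apply, LinearMap.mulLeft_apply, LinearMap.sum_apply, h,
      detForm_ιMulti]
    rw [Matrix.det_succ_row_zero, Finset.sum_range]
    refine Finset.sum_congr rfl fun l _ => ?_
    congr 2
    ext j k
    simp only [Matrix.submatrix_apply, Matrix.of_apply, Fin.cons_succ]
    rcases lt_or_ge (k : ℕ) l with hk | hk
    · rw [if_pos hk, Fin.succAbove_of_castSucc_lt _ _ hk]; rfl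
    · rw [if_neg hk.not_gt, Fin.succAbove_of_le_castSucc _ _ hk]; rfl

/-- Replacing each `g_l` by `g_l - c g_{l+1}`. -/
theorem detForm_sub_smul (g g' : ℕ → M₀ →ₗ[ℤ] R) (c : R)
    (h : ∀ l m, g l m = g' l m + c * g (l + 1) m) {r : ℕ} {x : Ext} (hx : x ∈ ⋀[ℤ]^r M₀) :
    (-1) ^ r * detForm g' x = ∑ l ∈ Finset.range (r + 1), (-1) ^ l * c ^ (r - l) *
      detForm (fun j => if j < l then g j else g (j + 1)) x := by
  have := exteriorPower_ext (L := LinearMap.mulLeft ℤ ((-1) ^ r) ∘ₗ detForm g')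
    (L' := ∑ l ∈ Finset.range (r + 1), (LinearMap.mulLeft ℤ ((-1) ^ l * c ^ (r - l))) ∘ₗ
      detForm (fun j => if j < l then g j else g (j + 1)))
    (fun m => ?_) hx
  · simpa [mul_assoc] using this
  · let A : Matrix (Fin (r + 1)) (Fin (r + 1)) R :=
      Fin.cons (fun l => c ^ (r - (l : ℕ))) fun k l => g l (m k)
    let A' : Matrix (Fin (r + 1)) (Fin (r + 1)) R :=
      Fin.cons (Fin.snoc (α := fun _ => R) (fun _ => 0) 1) fun k =>
        Fin.snoc (α := fun _ => R) (fun l => g' l (m k)) (g r (m k))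
    have hA : A.det = A'.det := by
      refine det_eq_of_forall_col_eq_smul_add_succ c (fun i => ?_) fun i j => ?_
      · refine Fin.cases ?_ (fun k => ?_) i <;> simp [A, A']
      · refine Fin.cases ?_ (fun k => ?_) i
        · have : r - (j : ℕ) = (r - (j + 1 : ℕ)) + 1 := by omega
          simp [A, A', this, pow_succ, mul_comm]
        · simpa [A, A'] using h j (m k)
    rw [Matrix.det_succ_row_zero, A'.det_succ_row_zero] at hA
    conv_rhs at hA =>
      rw [Fin.sum_univ_castSucc, Finset.sum_eq_zero (fun i _ => by simp [A']), zero_add]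
    simp only [LinearMap.comp_apply, LinearMap.mulLeft_apply, LinearMap.sum_apply,
      detForm_ιMulti]
    rw [Finset.sum_range]
    refine Eq.trans ?_ (hA.symm.trans (Finset.sum_congr rfl fun l _ => ?_))
    · have h₁ : A' 0 (Fin.last r) = 1 := by simp [A']
      have h₂ : A'.submatrix Fin.succ (Fin.last r).succAbove =
          Matrix.of fun k l : Fin r => g' l (m k) := by
        ext j k
        change Fin.snoc (α := fun _ => R) (fun l => g' l (m j)) (g r (m j))
          ((Fin.last r).succAbove k) = _
        simp
      rw [h₁, h₂, mul_one, Fin.val_last]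
    · congr 2
      ext j k
      change g (l.succAbove k : ℕ) (m j) = _
      rw [Matrix.of_apply]
      rcases lt_or_ge (k : ℕ) l with hk | hk
      · rw [if_pos hk, Fin.succAbove_of_castSucc_lt _ _ hk]; rfl
      · rw [if_neg hk.not_gt, Fin.succAbove_of_le_castSucc _ _ hk]; rfl

/-- Adding to each `g_l` a multiple of the next one, except for the last column. -/
theorem detForm_add_smul_succ (g g' : ℕ → M₀ →ₗ[ℤ] R) (c : R) {r : ℕ}
    (h : ∀ l < r, ∀ m, g' l m = g l m + c * g' (l + 1) m) (hr : g r = g' r)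
    {x : Ext} (hx : x ∈ ⋀[ℤ]^(r + 1) M₀) : detForm g' x = detForm g x := by
  refine exteriorPower_ext (fun m => ?_) hx
  rw [detForm_ιMulti, detForm_ιMulti]
  exact det_eq_of_forall_col_eq_smul_add_succ c (fun i => by simp [hr])
    fun i j => by simpa using h j j.2 (m i)

end DetForm

/-! ### Complete symmetric sequences -/

section Series

variable {R : Type} [CommRing R]

/-- The coefficients of a power series as a bilateral sequence. -/
def coeffZ (F : PowerSeries R) (j : ℤ) : R := if j < 0 then 0 else PowerSeries.coeff j.toNat F

theorem coeffZ_natCast (F : PowerSeries R) (n : ℕ) : coeffZ F n = PowerSeries.coeff n F := by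
  simp [coeffZ]

theorem coeffZ_of_neg (F : PowerSeries R) {j : ℤ} (hj : j < 0) : coeffZ F j = 0 := if_pos hj

theorem coeffZ_mul (F G : PowerSeries R) (n : ℤ) (T : ℕ) (hT : n < T) :
    coeffZ (F * G) n = ∑ t ∈ Finset.range T, PowerSeries.coeff t F * coeffZ G (n - t) := by
  obtain hn | hn := lt_or_ge n 0
  · rw [coeffZ_of_neg _ hn, Finset.sum_eq_zero]
    intro t _
    rw [coeffZ_of_neg _ (by omega), mul_zero]
  · lift n to ℕ using hn
    rw [coeffZ_natCast, PowerSeries.coeff_mul, Finset.Nat.sum_antidiagonal_eq_sum_range_succ_mk]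
    refine Finset.sum_subset_zero_on_sdiff (by simp; omega) (fun t ht => ?_) fun t ht => ?_
    · simp only [Finset.mem_sdiff, Finset.mem_range, not_lt] at ht
      rw [coeffZ_of_neg _ (by omega), mul_zero]
    · simp only [Finset.mem_range] at ht
      rw [← Nat.cast_sub (by omega), coeffZ_natCast]

theorem coeffZ_one_sub_mul (F : PowerSeries R) (c : R) (n : ℤ) :
    coeffZ ((1 - PowerSeries.C c * PowerSeries.X) * F) n =
      coeffZ F n - c * coeffZ F (n - 1) := by
  obtain hn | hn := lt_or_ge n 0
  · simp [coeffZ_of_neg _ hn, coeffZ_of_neg F (show n - 1 < 0 by omega)]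
  · lift n to ℕ using hn
    rw [coeffZ_natCast, coeffZ_natCast, sub_mul, one_mul, map_sub, mul_assoc,
      PowerSeries.coeff_C_mul]
    cases n with
    | zero => simp [coeffZ_of_neg]
    | succ n =>
      rw [PowerSeries.coeff_succ_X_mul, Nat.cast_succ, add_sub_cancel_right, coeffZ_natCast]

theorem coeffZ_one (n : ℤ) : coeffZ (1 : PowerSeries R) n = if n = 0 then 1 else 0 := by
  obtain hn | hn := lt_or_ge n 0
  · rw [coeffZ_of_neg _ hn, if_neg (by omega)]
  · lift n to ℕ using hn
    rw [coeffZ_natCast, PowerSeries.coeff_one]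
    simp

theorem coeffZ_map {S : Type} [CommRing S] (f : R →+* S) (F : PowerSeries R) (n : ℤ) :
    coeffZ (PowerSeries.map f F) n = f (coeffZ F n) := by
  unfold coeffZ
  split_ifs <;> simp

theorem h_eq_coeffZ (e : ℕ → R) (n : ℤ) : h e n = coeffZ (seriesH e) n := rfl

theorem h_of_neg (e : ℕ → R) {n : ℤ} (hn : n < 0) : h e n = 0 := if_pos hn

theorem seriesE_mul_seriesH {e : ℕ → R} (he : e 0 = 1) : seriesE e * seriesH e = 1 :=
  PowerSeries.mul_invOfUnit _ _ (by simp [seriesE, he])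

theorem seriesH_eq {e : ℕ → R} (he : e 0 = 1) {F : PowerSeries R} (hF : seriesE e * F = 1) :
    seriesH e = F := by
  have := seriesE_mul_seriesH he
  calc seriesH e = seriesH e * (seriesE e * F) := by rw [hF, mul_one]
    _ = (seriesE e * seriesH e) * F := by ring
    _ = F := by rw [this, one_mul]

theorem map_seriesE {S : Type} [CommRing S] (f : R →+* S) (e : ℕ → R) :
    PowerSeries.map f (seriesE e) = seriesE fun n => f (e n) := by
  ext n
  simp [seriesE]

theorem map_h {S : Type} [CommRing S] (f : R →+* S) {e : ℕ → R} (he : e 0 = 1) (n : ℤ) :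
    f (h e n) = h (fun n => f (e n)) n := by
  rw [h_eq_coeffZ, h_eq_coeffZ, ← coeffZ_map]
  congr 1
  refine (seriesH_eq (by simp [he]) ?_).symm
  rw [← map_seriesE, ← map_mul, seriesE_mul_seriesH he, map_one]

/-- `∑ₜ (-1)ᵗ eₜ h_{n-t} = δ_{n,0}`. -/
theorem sum_e_mul_h {e : ℕ → R} (he : e 0 = 1) (n : ℤ) (T : ℕ) (hT : n < T) :
    ∑ t ∈ Finset.range T, (-1) ^ t * e t * h e (n - t) = if n = 0 then 1 else 0 := by
  rw [← coeffZ_one (R := R), ← seriesE_mul_seriesH he, coeffZ_mul _ _ _ T hT]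
  simp [seriesE, h_eq_coeffZ]

theorem h_zero {e : ℕ → R} (he : e 0 = 1) : h e 0 = 1 := by
  simpa [he] using sum_e_mul_h he 0 1 (by simp)

/-! ### The sequences attached to (1 - wz) E(z) and E(z) / (1 - wz). -/

open Polynomial in
/-- The sequence with generating series `(1 - w z) E(z)`. -/
def eShift (e : ℕ → R) : ℕ → R[X]
  | 0 => C (e 0)
  | n + 1 => C (e (n + 1)) + X * C (e n)

open Polynomial in
/-- The sequence with generating series `E(z) / (1 - w z)`. -/
def eShiftBar (e : ℕ → R) : ℕ → R[X]
  | 0 => C (e 0)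
  | n + 1 => C (e (n + 1)) - X * eShiftBar e n

theorem eShift_zero {e : ℕ → R} (he : e 0 = 1) : eShift e 0 = 1 := by simp [eShift, he]

theorem eShiftBar_zero {e : ℕ → R} (he : e 0 = 1) : eShiftBar e 0 = 1 := by simp [eShiftBar, he]

theorem seriesE_eShift (e : ℕ → R) : seriesE (eShift e) =
    (1 - PowerSeries.C Polynomial.X * PowerSeries.X) *
      PowerSeries.map Polynomial.C (seriesE e) := by
  ext1 n
  rw [sub_mul, one_mul, map_sub, mul_assoc, PowerSeries.coeff_C_mul]
  cases n with
  | zero => simp [seriesE, eShift]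
  | succ n =>
    rw [PowerSeries.coeff_succ_X_mul]
    simp only [seriesE, PowerSeries.coeff_mk, PowerSeries.coeff_map, map_mul, map_pow, map_neg,
      map_one, eShift]
    ring

theorem seriesE_eShiftBar (e : ℕ → R) :
    (1 - PowerSeries.C Polynomial.X * PowerSeries.X) * seriesE (eShiftBar e) =
      PowerSeries.map Polynomial.C (seriesE e) := by
  ext1 n
  rw [sub_mul, one_mul, map_sub, mul_assoc, PowerSeries.coeff_C_mul]
  cases n with
  | zero => simp [seriesE, eShiftBar]
  | succ n =>
    rw [PowerSeries.coeff_succ_X_mul]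
    simp only [seriesE, PowerSeries.coeff_mk, PowerSeries.coeff_map, map_mul, map_pow, map_neg,
      map_one, eShiftBar]
    ring

theorem h_eShift {e : ℕ → R} (he : e 0 = 1) (n : ℤ) :
    h (eShift e) n = Polynomial.C (h e n) + Polynomial.X * h (eShift e) (n - 1) := by
  have : PowerSeries.map Polynomial.C (seriesH e) =
      (1 - PowerSeries.C Polynomial.X * PowerSeries.X) * seriesH (eShift e) := by
    have h₁ := seriesE_mul_seriesH (eShift_zero he)
    rw [seriesE_eShift] at h₁
    have h₂ := congrArg (PowerSeries.map Polynomial.C) (seriesE_mul_seriesH he)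
    rw [map_mul, map_one] at h₂
    linear_combination (-PowerSeries.map Polynomial.C (seriesH e)) * h₁ +
      (1 - PowerSeries.C Polynomial.X * PowerSeries.X) * seriesH (eShift e) * h₂
  have h₁ := congrArg (coeffZ · n) this
  simp only [coeffZ_map, coeffZ_one_sub_mul] at h₁
  rw [h_eq_coeffZ e, h₁, h_eq_coeffZ, h_eq_coeffZ]
  ring

theorem h_eShiftBar {e : ℕ → R} (he : e 0 = 1) (n : ℤ) :
    h (eShiftBar e) n = Polynomial.C (h e n) - Polynomial.X * Polynomial.C (h e (n - 1)) := by
  have : seriesH (eShiftBar e) = (1 - PowerSeries.C Polynomial.X * PowerSeries.X) *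
      PowerSeries.map Polynomial.C (seriesH e) := by
    refine seriesH_eq (eShiftBar_zero he) ?_
    rw [mul_left_comm, ← mul_assoc, seriesE_eShiftBar, ← map_mul, seriesE_mul_seriesH he, map_one]
  rw [h_eq_coeffZ, this, coeffZ_one_sub_mul, coeffZ_map, coeffZ_map]
  rfl

theorem coeff_h_eShift {e : ℕ → R} (he : e 0 = 1) (n : ℤ) (j : ℕ) :
    (h (eShift e) n).coeff j = h e (n - j) := by
  induction j generalizing n with
  | zero => rw [h_eShift he]; simp
  | succ j ih =>
    rw [h_eShift he, Polynomial.coeff_add, Polynomial.coeff_C_succ, zero_add,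
      Polynomial.coeff_X_mul, ih]
    congr 1
    push_cast
    ring

/-- The linear form `bᵢ ↦ h_{i-l}`. -/
def hRow (e : ℕ → R) (l : ℕ) : M₀ →ₗ[ℤ] R :=
  Finsupp.linearCombination ℤ fun i : ℕ => h e ((i : ℤ) - l)

theorem hRow_b (e : ℕ → R) (l i : ℕ) : hRow e l (b i) = h e ((i : ℤ) - l) := by
  simp [hRow, b]

/-- The linear map `b_{i₀} ∧ ⋯ ∧ b_{i_{r-1}} ↦ det (h_{i_k - l})`. -/
def hForm (e : ℕ → R) : Ext →ₗ[ℤ] R := detForm (hRow e)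

theorem map_hForm {S : Type} [CommRing S] (f : R →+* S) {e : ℕ → R} (he : e 0 = 1) (x : Ext) :
    f (hForm e x) = hForm (fun n => f (e n)) x :=
  map_detForm f _ _ (fun l i => by rw [hRow_b, hRow_b, map_h f he]) x

/-- The factors of [b]ʳ_λ come with increasing indices, so transposing and reversing rows and
columns gives the Schur matrix. -/
theorem hForm_wedge (e : ℕ → R) (r : ℕ) (l : Part) :
    hForm e (wedge r l) = schur e r l := by
  rw [wedge, exteriorPower.ιMulti_apply_coe, hForm, detForm_ιMulti, schur,
    ← Matrix.det_transpose, ← Matrix.det_submatrix_equiv_self Fin.revPerm]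
  congr 1
  ext i j
  simp only [Matrix.submatrix_apply, Matrix.transpose_apply, Matrix.of_apply, hRow_b,
    Fin.revPerm_apply, Fin.val_rev]
  have h₁ : r - 1 - (r - (j + 1 : ℕ)) = j := by omega
  rw [h₁]
  congr 1
  have := i.2
  have := j.2
  omega

theorem Part.apply_eq_zero (l : Part) {r : ℕ} (h : l.length ≤ r) : l.1 r = 0 := by
  by_contra h0
  have : Finset.range (r + 1) ⊆ l.1.support := by
    intro i hi
    rw [Finset.mem_range] at hi
    have := l.2 (show i ≤ r by omega)
    rw [Finsupp.mem_support_iff]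
    omega
  have := Finset.card_le_card this
  rw [Finset.card_range] at this
  unfold Part.length at h
  omega

/-- A zero part makes the last column (0, …, 0, h₀), with h₀ = 1. -/
theorem schur_succ {e : ℕ → R} (he : e 0 = 1) (l : Part) {r : ℕ} (h0 : l.1 r = 0) :
    schur e (r + 1) l = schur e r l := by
  rw [schur, Matrix.det_succ_column _ (Fin.last r), Fin.sum_univ_castSucc, Finset.sum_eq_zero,
    zero_add]
  · simp only [Fin.val_last, Matrix.of_apply, h0, ← two_mul, pow_mul]
    rw [show ((0 : ℕ) : ℤ) - r + r = 0 by simp, h_zero he]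
    simp [schur]
    rfl
  · intro i _
    simp only [Fin.val_last, Matrix.of_apply, h0, Fin.val_castSucc]
    rw [h_of_neg e (by have := i.2; omega)]
    simp

theorem schur_eq_schur_length {e : ℕ → R} (he : e 0 = 1) (l : Part) {r : ℕ} (h : l.length ≤ r) :
    schur e r l = schur e l.length l := by
  induction r, h using Nat.le_induction with
  | base => rfl
  | succ r hr ih => rw [schur_succ he l (l.apply_eq_zero hr), ih]

end Series

/-! ### The bases of the exterior powers -/

/-- The basis `b₀, b₁, …` of `M₀`. -/
def bBasis : Module.Basis ℕ ℤ M₀ := Finsupp.basisSingleOne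

theorem bBasis_apply (i : ℕ) : bBasis i = b i := by simp [bBasis, b]

theorem orderEmb_add_le {r : ℕ} (f : Fin r ↪o ℕ) (i d : ℕ) (h : i + d < r) :
    f ⟨i, by omega⟩ + d ≤ f ⟨i + d, h⟩ := by
  induction d with
  | zero => simp
  | succ d ih =>
    have h₁ := ih (by omega)
    have h₂ : f ⟨i + d, by omega⟩ < f ⟨i + (d + 1), h⟩ := f.strictMono (by simp [Fin.lt_def])
    omega

/-- Subtract the staircase: the numbers f(i) - i, read backwards, form the partition. -/
theorem exists_wedge_eq {r : ℕ} (f : Fin r ↪o ℕ) :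
    ∃ l : Part, l.length ≤ r ∧ wedge r l = exteriorPower.ιMulti ℤ r fun i => b (f i) := by
  let l : ℕ →₀ ℕ := Finsupp.onFinset (Finset.range r)
    (fun j => if h : j < r then f ⟨r - 1 - j, by omega⟩ - (r - 1 - j) else 0)
    (fun j hj => by by_contra h; simp_all)
  have hl : Antitone l := by
    intro j j' hj
    change (if h : j' < r then f ⟨r - 1 - j', by omega⟩ - (r - 1 - j') else 0) ≤
      (if h : j < r then f ⟨r - 1 - j, by omega⟩ - (r - 1 - j) else 0)
    by_cases h : j' < r
    · rw [dif_pos h, dif_pos (by omega)]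
      have := orderEmb_add_le f (r - 1 - j') (j' - j) (by omega)
      simp only [show r - 1 - j' + (j' - j) = r - 1 - j by omega] at this
      omega
    · rw [dif_neg h]
      exact Nat.zero_le _
  refine ⟨⟨l, hl⟩, ?_, ?_⟩
  · have := Finset.card_le_card (Finsupp.support_onFinset_subset : l.support ⊆ Finset.range r)
    rwa [Finset.card_range] at this
  · rw [wedge]
    congr 1
    ext1 i
    congr 1
    change (i : ℕ) + (if h : r - 1 - (i : ℕ) < r then
      f ⟨r - 1 - (r - 1 - i), by omega⟩ - (r - 1 - (r - 1 - i)) else 0) = f i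
    have hi := i.2
    rw [dif_pos (by omega)]
    have h₁ := orderEmb_add_le f 0 i (by omega)
    simp only [show r - 1 - (r - 1 - (i : ℕ)) = i by omega, zero_add, Fin.eta] at h₁ ⊢
    omega

theorem exteriorPower_basis_apply {r : ℕ} (s : Set.powersetCard ℕ r) :
    bBasis.exteriorPower r s =
      exteriorPower.ιMulti ℤ r fun i => b (Set.powersetCard.ofFinEmbEquiv.symm s i) := by
  rw [exteriorPower.basis_apply, exteriorPower.ιMulti_family]
  simp only [Function.comp_def, bBasis_apply]

theorem wedgeSum_surjective (r : ℕ) : Function.Surjective (wedgeSum r) := by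
  rw [← LinearMap.range_eq_top, eq_top_iff, ← (bBasis.exteriorPower r).span_eq,
    Submodule.span_le]
  rintro _ ⟨s, rfl⟩
  rw [exteriorPower_basis_apply]
  obtain ⟨l, hl, h⟩ := exists_wedge_eq (Set.powersetCard.ofFinEmbEquiv.symm s)
  exact ⟨Finsupp.single ⟨l, hl⟩ 1, by simp [wedgeSum, h]⟩

theorem hForm_wedgeSum {R : Type} [CommRing R] (e : ℕ → R) {r : ℕ} (a : PartLE r →₀ ℤ) :
    hForm e (wedgeSum r a) = a.sum fun l c => c • schur e r l.1 := by
  rw [wedgeSum, Finsupp.linearCombination_apply, Finsupp.sum, Finsupp.sum]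
  simp [hForm_wedge, -zsmul_eq_mul]

theorem hForm_wedge_eInf {r : ℕ} (l : Part) (h : l.length ≤ r) :
    hForm eInf (wedge r l) = schurInf l := by
  rw [hForm_wedge, schurInf, schur_eq_schur_length rfl l h]

/-- Since `hForm eInf` sends [b]ʳ_λ to Δ_λ, any choice of coefficients for m gives the same value;
only surjectivity of `wedgeSum` is needed. -/
theorem toBInf_eq (r : ℕ) (m : ⋀[ℤ]^r M₀) : toBInf r m = hForm eInf m := by
  conv_rhs => rw [← Function.rightInverse_invFun (wedgeSum_surjective r) m]
  rw [toBInf, hForm_wedgeSum, schurSumInf, Finsupp.linearCombination_apply,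
    Finsupp.sum_mapDomain_index (by simp) (by simp [add_smul, -zsmul_eq_mul])]
  refine Finsupp.sum_congr fun l _ => ?_
  rw [schurInf, schur_eq_schur_length rfl l.1 l.2]

theorem hForm_mem_range_schurSumInf {r : ℕ} {x : Ext} (hx : x ∈ ⋀[ℤ]^r M₀) :
    hForm eInf x ∈ LinearMap.range schurSumInf := by
  rw [← toBInf_eq r ⟨x, hx⟩]
  exact ⟨_, rfl⟩

/-! ### Injectivity of the determinantal form -/

section Alternants

variable (r : ℕ)

/-- The linear form `bᵢ ↦ xⱼⁱ`. -/
def powRow (l : ℕ) : M₀ →ₗ[ℤ] MvPolynomial (Fin r) ℤ :=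
  Finsupp.linearCombination ℤ fun i : ℕ =>
    if hl : l < r then (MvPolynomial.X ⟨l, hl⟩ : MvPolynomial (Fin r) ℤ) ^ i else 0

/-- The coefficients of `∏ⱼ (1 - xⱼ z)`, up to sign. -/
def eSymm (n : ℕ) : MvPolynomial (Fin r) ℤ :=
  (-1) ^ n * PowerSeries.coeff n
    (∏ j : Fin r, (1 - PowerSeries.C (MvPolynomial.X j) * PowerSeries.X))

theorem seriesE_eSymm : seriesE (eSymm r) =
    ∏ j : Fin r, (1 - PowerSeries.C (MvPolynomial.X j) * PowerSeries.X) := by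
  ext1 n
  simp [seriesE, eSymm, ← mul_assoc, ← mul_pow]

theorem eSymm_zero : eSymm r 0 = 1 := by
  rw [eSymm, PowerSeries.coeff_zero_eq_constantCoeff_apply, map_prod]
  simp

theorem coeff_prod_one_sub_eq_zero {R ι : Type} [CommRing R] (s : Finset ι) (x : ι → R) {n : ℕ}
    (hn : s.card < n) :
    PowerSeries.coeff n (∏ j ∈ s, (1 - PowerSeries.C (x j) * PowerSeries.X)) = 0 := by
  classical
  induction s using Finset.induction_on generalizing n with
  | empty =>
    rw [Finset.prod_empty, PowerSeries.coeff_one, if_neg (by simp at hn; omega)]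
  | insert a s ha ih =>
    rw [Finset.card_insert_of_notMem ha] at hn
    obtain ⟨n, rfl⟩ : ∃ n', n = n' + 1 := ⟨n - 1, by omega⟩
    rw [Finset.prod_insert ha, sub_mul, one_mul, map_sub, mul_assoc, PowerSeries.coeff_C_mul,
      PowerSeries.coeff_succ_X_mul, ih (by omega), ih (by omega), mul_zero, sub_zero]

theorem eSymm_of_lt {n : ℕ} (hn : r < n) : eSymm r n = 0 := by
  rw [eSymm, coeff_prod_one_sub_eq_zero _ _ (by simpa using hn), mul_zero]

/-- The coefficients of `∏_{i ≠ j} (1 - xᵢ z)`. -/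
def eSymmErase (j : Fin r) (l : ℕ) : MvPolynomial (Fin r) ℤ :=
  PowerSeries.coeff l
    (∏ i ∈ Finset.univ.erase j, (1 - PowerSeries.C (MvPolynomial.X i) * PowerSeries.X))

/-- Compare coefficients in 1/(1 - xⱼz) = H(z) ∏_{i ≠ j} (1 - xᵢz). The product has degree at most r
- 1, so l < r suffices. -/
theorem X_pow_eq_sum (j : Fin r) (n : ℕ) : (MvPolynomial.X j : MvPolynomial (Fin r) ℤ) ^ n =
    ∑ l : Fin r, h (eSymm r) ((n : ℤ) - (l : ℕ)) * eSymmErase r j l := by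
  have h₁ : (∏ i ∈ Finset.univ.erase j,
      (1 - PowerSeries.C (MvPolynomial.X i) * PowerSeries.X)) * seriesH (eSymm r) =
      PowerSeries.mk fun n => (MvPolynomial.X j : MvPolynomial (Fin r) ℤ) ^ n := by
    have h₂ : (1 - PowerSeries.C (MvPolynomial.X j) * PowerSeries.X) *
        PowerSeries.mk (fun n => (MvPolynomial.X j : MvPolynomial (Fin r) ℤ) ^ n) = 1 := by
      ext1 n
      rw [sub_mul, one_mul, map_sub, mul_assoc, PowerSeries.coeff_C_mul]
      cases n with
      | zero => simp
      | succ n =>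
        rw [PowerSeries.coeff_succ_X_mul, PowerSeries.coeff_mk, PowerSeries.coeff_mk,
          PowerSeries.coeff_one, pow_succ', sub_self, if_neg (by omega)]
    have h₃ := seriesE_mul_seriesH (eSymm_zero r)
    rw [seriesE_eSymm, ← Finset.mul_prod_erase _ _ (Finset.mem_univ j)] at h₃
    linear_combination (-(∏ i ∈ Finset.univ.erase j,
      (1 - PowerSeries.C (MvPolynomial.X i) * PowerSeries.X)) * seriesH (eSymm r)) * h₂ +
      PowerSeries.mk (fun n => (MvPolynomial.X j : MvPolynomial (Fin r) ℤ) ^ n) * h₃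
  have h₂ := congrArg (coeffZ · (n : ℤ)) h₁
  simp only [coeffZ_natCast, PowerSeries.coeff_mk] at h₂
  rw [← h₂, ← coeffZ_natCast, coeffZ_mul _ _ _ (n + r + 1) (by push_cast; omega),
    Fin.sum_univ_eq_sum_range (fun l => h (eSymm r) ((n : ℤ) - (l : ℕ)) * eSymmErase r j l)]
  symm
  refine Finset.sum_subset_zero_on_sdiff (by simp; omega) (fun l hl => ?_) fun l _ => ?_
  · simp only [Finset.mem_sdiff, Finset.mem_range, not_lt] at hl
    rw [coeff_prod_one_sub_eq_zero _ _ ?_, zero_mul]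
    have := j.2
    rw [Finset.card_erase_of_mem (Finset.mem_univ j), Finset.card_univ, Fintype.card_fin]
    omega
  · rw [mul_comm]
    rfl

/-- By `X_pow_eq_sum` the matrix of powers is the matrix of h's times a fixed matrix. -/
theorem detForm_powRow_eq_zero {x : Ext} (hx : x ∈ ⋀[ℤ]^r M₀) (h0 : hForm (eSymm r) x = 0) :
    detForm (powRow r) x = 0 := by
  let c : Matrix (Fin r) (Fin r) (MvPolynomial (Fin r) ℤ) :=
    Matrix.of fun l j => eSymmErase r j l
  have hrow : ∀ (j : Fin r) (m : M₀),
      powRow r j m = ∑ l : Fin r, hRow (eSymm r) l m * eSymmErase r j l := by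
    intro j m
    induction m using Finsupp.induction_linear with
    | zero => simp
    | add u v hu hv => simp only [map_add, hu, hv, add_mul, Finset.sum_add_distrib]
    | single i a =>
      simp only [powRow, hRow, Finsupp.linearCombination_single, j.2, dite_true, Fin.eta,
        X_pow_eq_sum, Finset.smul_sum, smul_mul_assoc]
  have := exteriorPower_ext (L := detForm (powRow r))
    (L' := LinearMap.mulRight ℤ c.det ∘ₗ hForm (eSymm r)) (fun m => ?_) hx
  · rw [this, LinearMap.comp_apply, h0, map_zero]
  · rw [LinearMap.comp_apply, LinearMap.mulRight_apply, hForm, detForm_ιMulti, detForm_ιMulti,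
      ← Matrix.det_mul]
    congr 1
    ext1 k j
    rw [Matrix.of_apply, hrow, Matrix.mul_apply]
    rfl

/-- A monomial of the alternant is a permutation of f'. If it equals f, both sequences being
increasing, the permutation is the identity. -/
theorem coeff_detForm_powRow (f f' : Fin r ↪o ℕ) :
    MvPolynomial.coeff (Finsupp.equivFunOnFinite.symm f)
      (detForm (powRow r) (ExteriorAlgebra.ιMulti ℤ r fun i => b (f' i))) =
      if f' = f then 1 else 0 := by
  have hM : (Matrix.of fun k l : Fin r => powRow r l (b (f' k))) =
      Matrix.of fun k l : Fin r => (MvPolynomial.X l : MvPolynomial (Fin r) ℤ) ^ f' k := by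
    ext1 k l
    simp [powRow, b]
  have hprod : ∀ σ : Equiv.Perm (Fin r),
      ∏ i, (MvPolynomial.X i : MvPolynomial (Fin r) ℤ) ^ f' (σ i) =
        MvPolynomial.monomial (Finsupp.equivFunOnFinite.symm fun i => f' (σ i)) 1 := by
    intro σ
    rw [MvPolynomial.monomial_eq]
    simp [Finsupp.prod_fintype]
  rw [detForm_ιMulti, hM, Matrix.det_apply]
  simp only [Matrix.of_apply, hprod, MvPolynomial.coeff_sum, Units.smul_def,
    MvPolynomial.coeff_smul, MvPolynomial.coeff_monomial, EmbeddingLike.apply_eq_iff_eq]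
  have hσ : ∀ σ : Equiv.Perm (Fin r), (fun i => f' (σ i)) = f → σ = 1 := by
    intro σ hσ
    have : StrictMono σ := fun i j hij => by
      rw [← f'.lt_iff_lt]
      have h₁ := congrFun hσ i
      have h₂ := congrFun hσ j
      have h₃ := f.strictMono hij
      rwa [← h₁, ← h₂] at h₃
    let τ : Fin r ≃o Fin r := ⟨σ, this.le_iff_le⟩
    have hτ : τ = OrderIso.refl _ := Subsingleton.elim _ _
    exact congrArg RelIso.toEquiv hτ
  rw [Finset.sum_eq_single 1]
  · simp only [Equiv.Perm.sign_one, Equiv.Perm.one_apply, Units.val_one, one_smul]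
    simp only [DFunLike.ext'_iff]
    rfl
  · intro σ _ h1
    rw [if_neg fun h => h1 (hσ σ h), smul_zero]
  · simp

theorem eq_zero_of_detForm_powRow {x : Ext} (hx : x ∈ ⋀[ℤ]^r M₀)
    (h0 : detForm (powRow r) x = 0) : x = 0 := by
  have key : ∀ s : Set.powersetCard ℕ r, (bBasis.exteriorPower r).coord s =
      (MvPolynomial.lcoeff ℤ (Finsupp.equivFunOnFinite.symm
        (Set.powersetCard.ofFinEmbEquiv.symm s : Fin r → ℕ))) ∘ₗ
        detForm (powRow r) ∘ₗ (⋀[ℤ]^r M₀).subtype := by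
    intro s
    refine (bBasis.exteriorPower r).ext fun t => ?_
    rw [Module.Basis.coord_apply, Module.Basis.repr_self, exteriorPower_basis_apply]
    simp only [LinearMap.comp_apply, Submodule.subtype_apply, exteriorPower.ιMulti_apply_coe,
      MvPolynomial.lcoeff_apply, coeff_detForm_powRow, EmbeddingLike.apply_eq_iff_eq]
    exact Finsupp.single_apply
  have : (⟨x, hx⟩ : ⋀[ℤ]^r M₀) = 0 := by
    refine (bBasis.exteriorPower r).ext_elem fun s => ?_
    rw [map_zero, Finsupp.zero_apply, ← Module.Basis.coord_apply, key]
    simp [h0]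
  exact congrArg Subtype.val this

theorem eq_zero_of_hForm {R : Type} [CommRing R] {e : ℕ → R} (he : e 0 = 1)
    (f : R →+* MvPolynomial (Fin r) ℤ) (hf : ∀ n, f (e n) = eSymm r n) {x : Ext}
    (hx : x ∈ ⋀[ℤ]^r M₀) (h0 : hForm e x = 0) : x = 0 := by
  refine eq_zero_of_detForm_powRow r hx (detForm_powRow_eq_zero r hx ?_)
  have := map_hForm f he x
  simpa [hf, h0] using this.symm

variable {r}

theorem eq_zero_of_hForm_eInf {x : Ext} (hx : x ∈ ⋀[ℤ]^r M₀) (h0 : hForm eInf x = 0) : x = 0 := by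
  refine eq_zero_of_hForm r rfl
    (MvPolynomial.aeval fun n => eSymm r (n + 1) : BInf →ₐ[ℤ] MvPolynomial (Fin r) ℤ).toRingHom
    (fun n => ?_) hx h0
  cases n with
  | zero => simp [eInf, eSymm_zero]
  | succ n => simp [eInf]

theorem eq_zero_of_hForm_e {x : Ext} (hx : x ∈ ⋀[ℤ]^r M₀) (h0 : hForm (e r) x = 0) : x = 0 := by
  refine eq_zero_of_hForm r rfl
    (MvPolynomial.aeval fun n : Fin r => eSymm r (n + 1) :
      B r →ₐ[ℤ] MvPolynomial (Fin r) ℤ).toRingHom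
    (fun n => ?_) hx h0
  cases n with
  | zero => simp [e, eSymm_zero]
  | succ n =>
    by_cases hn : n < r
    · simp [e, hn]
    · simp [e, hn, eSymm_of_lt r (show r < n + 1 by omega)]

end Alternants

/-! ### Schubert derivations on the polynomial ring -/

section

variable {R : Type} [CommRing R]

/-- A linear map applied to all coefficients of a polynomial. -/
def polyMap (L : Ext →ₗ[ℤ] R) : Polynomial Ext →ₗ[ℤ] Polynomial R :=
  Polynomial.lsum fun k => ((Polynomial.monomial k).restrictScalars ℤ) ∘ₗ L

theorem polyMap_apply (L : Ext →ₗ[ℤ] R) (P : Polynomial Ext) :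
    polyMap L P = ∑ k ∈ P.support, Polynomial.monomial k (L (P.coeff k)) := rfl

theorem polyMap_monomial (L : Ext →ₗ[ℤ] R) (k : ℕ) (x : Ext) :
    polyMap L (Polynomial.monomial k x) = Polynomial.monomial k (L x) := by
  simp [polyMap, Polynomial.sum_monomial_index]

theorem coeff_polyMap (L : Ext →ₗ[ℤ] R) (P : Polynomial Ext) (k : ℕ) :
    (polyMap L P).coeff k = L (P.coeff k) := by
  rw [polyMap_apply, Polynomial.finsetSum_coeff]
  simp only [Polynomial.coeff_monomial, Finset.sum_ite_eq']
  split_ifs with h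
  · rfl
  · rw [Polynomial.notMem_support_iff.1 h, map_zero]

/-- A linear form applied to all coefficients of an element of `M₀[w]`. -/
def polyRow (g : M₀ →ₗ[ℤ] R) : (ℕ →₀ M₀) →ₗ[ℤ] Polynomial R :=
  Finsupp.lsum ℤ fun j => ((Polynomial.monomial j).restrictScalars ℤ) ∘ₗ g

theorem polyRow_single (g : M₀ →ₗ[ℤ] R) (j : ℕ) (m : M₀) :
    polyRow g (Finsupp.single j m) = Polynomial.monomial j (g m) := by
  simp [polyRow]

theorem prod_monomial_ofFn {r : ℕ} (j : Fin r → ℕ) (x : Fin r → Ext) :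
    (List.ofFn fun i => Polynomial.monomial (j i) (x i)).prod =
      Polynomial.monomial (∑ i, j i) (List.ofFn x).prod := by
  induction r with
  | zero => simp
  | succ r ih =>
    rw [List.ofFn_succ, List.prod_cons, ih, Polynomial.monomial_mul_monomial, Fin.sum_univ_succ,
      List.ofFn_succ, List.prod_cons]

/-- Both sides are multilinear in vectors of M₀[w], and for monomial vectors the powers of w factor
out of the rows of the determinant. -/
theorem polyMap_hasseSchmidt (g : ℕ → M₀ →ₗ[ℤ] R) (f : M₀ →ₗ[ℤ] (ℕ →₀ M₀)) {r : ℕ} {x : Ext}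
    (hx : x ∈ ⋀[ℤ]^r M₀) :
    polyMap (detForm g) (hasseSchmidt f x) = detForm (fun l => polyRow (g l) ∘ₗ f) x := by
  have key : (polyMap (detForm g)).compMultilinearMap
      ((MultilinearMap.mkPiAlgebraFin ℤ r (Polynomial Ext)).compLinearMap fun _ => toExtPoly) =
      ((Matrix.detRowAlternating (n := Fin r) (R := Polynomial R)).toMultilinearMap.restrictScalars
        ℤ).compLinearMap fun _ => LinearMap.pi fun l : Fin r => polyRow (g l) := by
    refine Module.Basis.ext_multilinear (fun _ => Finsupp.basis fun _ => bBasis) fun v => ?_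
    have hv : ∀ i : Fin r, (Finsupp.basis fun _ : ℕ => bBasis) (v i) =
        Finsupp.single (v i).1 (b (v i).2) := fun i => by simp [bBasis_apply]
    simp only [hv, LinearMap.compMultilinearMap_apply, MultilinearMap.compLinearMap_apply,
      MultilinearMap.mkPiAlgebraFin_apply, toExtPoly_single]
    rw [prod_monomial_ofFn, ← ExteriorAlgebra.ιMulti_apply, polyMap_monomial, detForm_ιMulti]
    change _ = Matrix.det (Matrix.of fun k l : Fin r =>
      polyRow (g l) (Finsupp.single (v k).1 (b (v k).2)))
    simp only [polyRow_single]
    have h₁ : (Matrix.of fun k l : Fin r => Polynomial.monomial (v k).1 (g l (b (v k).2))) =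
        Matrix.of fun k l : Fin r => (Polynomial.X ^ (v k).1) *
          (Matrix.of fun k l : Fin r => Polynomial.C (g l (b (v k).2))) k l := by
      ext1 k l
      rw [Matrix.of_apply, Matrix.of_apply, Matrix.of_apply, mul_comm,
        Polynomial.C_mul_X_pow_eq_monomial]
    rw [h₁, Matrix.det_mul_column, Finset.prod_pow_eq_pow_sum,
      ← Polynomial.C_mul_X_pow_eq_monomial, mul_comm, RingHom.map_det]
    rfl
  refine exteriorPower_ext (L := polyMap (detForm g) ∘ₗ (hasseSchmidt f).toLinearMap)
    (fun m => ?_) hx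
  have := congrArg (fun F => F fun i => f (m i)) key
  rw [detForm_ιMulti]
  simp only [LinearMap.compMultilinearMap_apply, MultilinearMap.compLinearMap_apply,
      MultilinearMap.mkPiAlgebraFin_apply] at this
  refine Eq.trans ?_ this
  rw [LinearMap.comp_apply, AlgHom.toLinearMap_apply, ExteriorAlgebra.ιMulti_apply, map_list_prod,
    List.map_ofFn]
  have h₁ : (fun i => toExtPoly (f (m i))) =
      ⇑(hasseSchmidt f) ∘ fun i => ExteriorAlgebra.ι ℤ (m i) := by
    ext1 i
    simp [hasseSchmidt]
  rw [h₁]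

theorem linearMap_ext_b {N : Type*} [AddCommGroup N] {L L' : M₀ →ₗ[ℤ] N}
    (h : ∀ i, L (b i) = L' (b i)) : L = L' :=
  Finsupp.lhom_ext' fun i => LinearMap.ext_ring (h i)

/-- Row by row, ∑ h_{i-j-l} wʲ is the coefficient of z^{i-l} in H(z)/(1 - wz); the terms with j > i
vanish. -/
theorem polyMap_sigmaMinus {e : ℕ → R} (he : e 0 = 1) {r : ℕ} {x : Ext} (hx : x ∈ ⋀[ℤ]^r M₀) :
    polyMap (hForm e) (sigmaMinus x) = hForm (eShift e) x := by
  rw [sigmaMinus, hForm, polyMap_hasseSchmidt _ _ hx, hForm]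
  congr 2
  ext1 l
  refine linearMap_ext_b fun i => ?_
  rw [hRow_b, LinearMap.comp_apply, shiftMinus, b, Finsupp.linearCombination_single, one_smul,
    map_sum]
  ext1 j
  simp only [polyRow_single, Polynomial.finsetSum_coeff, Polynomial.coeff_monomial,
    Finset.sum_ite_eq', coeff_h_eShift he, Finset.mem_range]
  split_ifs with hj
  · rw [hRow_b, Nat.cast_sub (by omega)]
    congr 1
    ring
  · rw [h_of_neg _ (by omega)]

theorem polyMap_sigmaBarMinus {e : ℕ → R} (he : e 0 = 1) {r : ℕ} {x : Ext}
    (hx : x ∈ ⋀[ℤ]^r M₀) :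
    polyMap (hForm e) (sigmaBarMinus x) = hForm (eShiftBar e) x := by
  rw [sigmaBarMinus, hForm, polyMap_hasseSchmidt _ _ hx, hForm]
  congr 2
  ext1 l
  refine linearMap_ext_b fun i => ?_
  rw [hRow_b, LinearMap.comp_apply, shiftBarMinus, b, Finsupp.linearCombination_single, one_smul,
    map_sub, h_eShiftBar he, polyRow_single, hRow_b, Polynomial.monomial_zero_left]
  congr 1
  split_ifs with hi
  · rw [h_of_neg _ (by omega)]
    simp
  · rw [polyRow_single, hRow_b, mul_comm, Polynomial.C_mul_X_eq_monomial,
      Nat.cast_sub (by omega)]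
    congr 2
    push_cast
    ring

/-! ### Vertex operators -/

/-- The minor form with the column `l` left out. -/
def hFormErase (e : ℕ → R) (l : ℕ) : Ext →ₗ[ℤ] R :=
  detForm fun j => if j < l then hRow e j else hRow e (j + 1)

/-- The new columns are g_l - w g_{l+1}, so `detForm_sub_smul` expands the determinant into minors
with one of r + 1 columns omitted. -/
theorem coeff_hForm_eShiftBar {e : ℕ → R} (he : e 0 = 1) {r : ℕ} {x : Ext} (hx : x ∈ ⋀[ℤ]^r M₀)
    (j : ℕ) : (-1) ^ r * (hForm (eShiftBar e) x).coeff j =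
      if j < r + 1 then (-1) ^ (r - j) * hFormErase e (r - j) x else 0 := by
  let CL : R →ₗ[ℤ] Polynomial R := (Polynomial.C : R →+* Polynomial R).toAddMonoidHom.toIntLinearMap
  have h₁ := detForm_sub_smul (fun l => CL ∘ₗ hRow e l) (hRow (eShiftBar e)) Polynomial.X
    (fun l m => by
      have : CL ∘ₗ hRow e l = hRow (eShiftBar e) l +
          LinearMap.mulLeft ℤ Polynomial.X ∘ₗ CL ∘ₗ hRow e (l + 1) := by
        refine linearMap_ext_b fun i => ?_
        simp only [LinearMap.add_apply, LinearMap.comp_apply, hRow_b, h_eShiftBar he,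
          LinearMap.mulLeft_apply]
        change Polynomial.C _ = _ - _ + Polynomial.X * Polynomial.C _
        rw [show (i : ℤ) - ((l + 1 : ℕ) : ℤ) = i - l - 1 by push_cast; ring, sub_add_cancel]
      exact DFunLike.congr_fun this m) hx
  have h₂ : ∀ l, detForm (fun j => if j < l then CL ∘ₗ hRow e j else CL ∘ₗ hRow e (j + 1)) x =
      Polynomial.C (hFormErase e l x) := by
    intro l
    refine (map_detForm (Polynomial.C : R →+* Polynomial R) _ _ (fun j i => ?_) x).symm
    split_ifs <;> rfl
  simp only [h₂] at h₁
  rw [← Finset.sum_range_reflect] at h₁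
  have h₃ := congrArg (Polynomial.coeff · j) h₁
  rw [show (-1 : Polynomial R) ^ r = Polynomial.C ((-1) ^ r) by simp] at h₃
  simp only [Polynomial.coeff_C_mul, Polynomial.finsetSum_coeff] at h₃
  rw [hForm, h₃]
  have h₄ : ∀ i ∈ Finset.range (r + 1), ((-1) ^ (r + 1 - 1 - i) *
      Polynomial.X ^ (r - (r + 1 - 1 - i)) *
        Polynomial.C (hFormErase e (r + 1 - 1 - i) x)).coeff j =
      if i = j then (-1) ^ (r - i) * hFormErase e (r - i) x else 0 := by
    intro i hi
    rw [Finset.mem_range] at hi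
    rw [show r + 1 - 1 - i = r - i by omega, show r - (r - i) = i by omega,
      ← Polynomial.coeff_monomial, ← Polynomial.C_mul_X_pow_eq_monomial]
    simp only [map_mul, map_pow, map_neg, map_one]
    congr 1
    ring
  rw [Finset.sum_congr rfl h₄, Finset.sum_ite_eq']
  simp

/-- The operator `b_{k+r} ∧ ·` on `⋀ʳ M₀` in terms of determinants. -/
theorem sum_h_mul_coeff {e : ℕ → R} (he : e 0 = 1) {r : ℕ} {x : Ext} (hx : x ∈ ⋀[ℤ]^r M₀)
    (n : ℕ) : ∑ j ∈ Finset.range (r + 1),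
      h e ((n : ℤ) - r + j) * (hForm (eShiftBar e) x).coeff j =
      (-1) ^ r * hForm e (ExteriorAlgebra.ι ℤ (b n) * x) := by
  have h1 : ((-1 : R) ^ r) * (-1) ^ r = 1 := by rw [← mul_pow]; simp
  rw [hForm.eq_def e, detForm_ι_mul _ _ hx, Finset.mul_sum]
  conv_rhs => rw [← Finset.sum_range_reflect]
  refine Finset.sum_congr rfl fun j hj => ?_
  rw [Finset.mem_range] at hj
  have h₂ := coeff_hForm_eShiftBar he hx j
  rw [if_pos hj] at h₂
  rw [hRow_b, show r + 1 - 1 - j = r - j by omega, Nat.cast_sub (by omega),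
    show (n : ℤ) - (r - j) = n - r + j by ring]
  change _ = (-1) ^ r * ((-1) ^ (r - j) * _ * hFormErase e (r - j) x)
  linear_combination (-1) ^ r * h e (n - r + j) * h₂ -
    h e (n - r + j) * (hForm (eShiftBar e) x).coeff j * h1

/-- This is a determinant, expanded along its last column, in which column c occurs twice. -/
theorem contractSum_hRow_eq_zero (e : ℕ → R) {r c : ℕ} (hc : c < r) {x : Ext}
    (hx : x ∈ ⋀[ℤ]^(r + 1) M₀) :
    contractSum ((LinearMap.mul ℤ R).flip.compl₁₂ (hForm e) (hRow e c)) x = 0 := by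
  have h₁ := contractSum_detForm (hRow e) (Function.update (hRow e) r (hRow e c))
    (fun l hl => by rw [Function.update_of_ne hl.ne]) hx
  rw [Function.update_self] at h₁
  rw [hForm, h₁]
  have : detForm (Function.update (hRow e) r (hRow e c)) x = (0 : Ext →ₗ[ℤ] R) x := by
    refine exteriorPower_ext (fun m => ?_) hx
    rw [detForm_ιMulti, LinearMap.zero_apply]
    refine Matrix.det_zero_of_column_eq (i := ⟨c, by omega⟩) (j := Fin.last r)
      (by simp [Fin.ext_iff]; omega) fun k => ?_
    simp [Function.update_of_ne hc.ne]
  rw [this, LinearMap.zero_apply, mul_zero]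

/-- Column operations reduce all columns but the last to constants in w; the coefficient of wʲ in
the last one is the column h_{i-r-j}. -/
theorem contractSum_hRow_eq_coeff {e : ℕ → R} (he : e 0 = 1) {r : ℕ} {x : Ext}
    (hx : x ∈ ⋀[ℤ]^(r + 1) M₀) (j : ℕ) :
    contractSum ((LinearMap.mul ℤ R).flip.compl₁₂ (hForm e) (hRow e (r + j))) x =
      (-1) ^ r * (hForm (eShift e) x).coeff j := by
  let CL : R →ₗ[ℤ] Polynomial R := (Polynomial.C : R →+* Polynomial R).toAddMonoidHom.toIntLinearMap
  let g' : ℕ → M₀ →ₗ[ℤ] Polynomial R :=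
    Function.update (fun l => CL ∘ₗ hRow e l) r (hRow (eShift e) r)
  have h₁ := contractSum_detForm (fun l => CL ∘ₗ hRow e l) g'
    (fun l hl => Function.update_of_ne hl.ne _ _) hx
  have h₂ : hForm (eShift e) x = detForm g' x := by
    refine detForm_add_smul_succ g' _ Polynomial.X (fun l hl m => ?_)
      (Function.update_self _ _ _) hx
    have : hRow (eShift e) l = CL ∘ₗ hRow e l +
          LinearMap.mulLeft ℤ Polynomial.X ∘ₗ hRow (eShift e) (l + 1) := by
      refine linearMap_ext_b fun i => ?_
      simp only [LinearMap.add_apply, LinearMap.comp_apply, hRow_b, LinearMap.mulLeft_apply]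
      rw [h_eShift he, show (i : ℤ) - ((l + 1 : ℕ) : ℤ) = i - l - 1 by push_cast; ring]
      rfl
    rw [show g' l = CL ∘ₗ hRow e l from Function.update_of_ne hl.ne _ _]
    exact DFunLike.congr_fun this m
  rw [← h₂] at h₁
  have h₃ := congrArg (Polynomial.coeff · j) h₁
  rw [show (-1 : Polynomial R) ^ r = Polynomial.C ((-1) ^ r) by simp] at h₃
  simp only [Polynomial.coeff_C_mul] at h₃
  rw [← h₃, contractSum_apply, contractSum_apply, Polynomial.finsetSum_coeff]
  refine Finset.sum_congr rfl fun i _ => ?_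
  have h₄ : detForm (fun l => CL ∘ₗ hRow e l) (contractions x i) =
      Polynomial.C (hForm e (contractions x i)) :=
    (map_detForm (Polynomial.C : R →+* Polynomial R) _ _ (fun j i => rfl) _).symm
  simp only [LinearMap.compl₁₂_apply, LinearMap.flip_apply, LinearMap.mul_apply', h₄,
    Polynomial.coeff_mul_C, g', Function.update_self]
  change hRow e (r + j) (b i) * _ = (hRow (eShift e) r (b i)).coeff j * _
  rw [hRow_b, hRow_b, coeff_h_eShift he]
  congr 2
  push_cast
  ring

end

/-! ### The substitutions induced by the Schubert derivations -/

/-- The substitution `E(z) ↦ (1 - w z) E(z)`. -/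
def shiftHom : BInf →ₐ[ℤ] Polynomial BInf := MvPolynomial.aeval fun n => eShift eInf (n + 1)

/-- The substitution `E(z) ↦ E(z) / (1 - w z)`. -/
def shiftBarHom : BInf →ₐ[ℤ] Polynomial BInf :=
  MvPolynomial.aeval fun n => eShiftBar eInf (n + 1)

theorem shiftHom_eInf (n : ℕ) : shiftHom (eInf n) = eShift eInf n := by
  cases n with
  | zero => simp [eInf, eShift]
  | succ n => simp [eInf, shiftHom]

theorem shiftBarHom_eInf (n : ℕ) : shiftBarHom (eInf n) = eShiftBar eInf n := by
  cases n with
  | zero => simp [eInf, eShiftBar]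
  | succ n => simp [eInf, shiftBarHom]

theorem shiftHom_hForm (x : Ext) : shiftHom (hForm eInf x) = hForm (eShift eInf) x := by
  have := map_hForm shiftHom.toRingHom (e := eInf) rfl x
  simpa [shiftHom_eInf] using this

theorem shiftBarHom_hForm (x : Ext) : shiftBarHom (hForm eInf x) = hForm (eShiftBar eInf) x := by
  have := map_hForm shiftBarHom.toRingHom (e := eInf) rfl x
  simpa [shiftBarHom_eInf] using this

theorem shiftBarHom_shiftHom (p : BInf) :
    Polynomial.eval₂ (shiftBarHom : BInf →+* Polynomial BInf) Polynomial.X (shiftHom p) =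
      Polynomial.C p := by
  have : (Polynomial.eval₂RingHom (shiftBarHom : BInf →+* Polynomial BInf) Polynomial.X).comp
      (shiftHom : BInf →+* Polynomial BInf) = Polynomial.C := by
    refine MvPolynomial.ringHom_ext' (RingHom.ext_int _ _) fun n => ?_
    have h₁ : (MvPolynomial.X n : BInf) = eInf (n + 1) := rfl
    rw [h₁, RingHom.comp_apply]
    change Polynomial.eval₂ _ _ (shiftHom _) = _
    rw [shiftHom_eInf, eShift, Polynomial.eval₂_add, Polynomial.eval₂_X_mul, Polynomial.eval₂_C,
      Polynomial.eval₂_C]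
    change shiftBarHom _ + shiftBarHom _ * _ = _
    rw [shiftBarHom_eInf, shiftBarHom_eInf, eShiftBar]
    ring
  exact DFunLike.congr_fun this p

/-- The coefficient of `zᵏ` in the product of a power series in `z` and a polynomial in
`w = z⁻¹`. -/
def pairing (F : PowerSeries BInf) (k : ℤ) : Polynomial BInf →ₗ[BInf] BInf :=
  Polynomial.lsum fun j => LinearMap.mulLeft BInf (coeffZ F (k + j))

theorem pairing_monomial (F : PowerSeries BInf) (k : ℤ) (j : ℕ) (c : BInf) :
    pairing F k (Polynomial.monomial j c) = coeffZ F (k + j) * c := by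
  simp [pairing, Polynomial.sum_monomial_index]

theorem pairing_eq_sum (F : PowerSeries BInf) (k : ℤ) (P : Polynomial BInf) {J : ℕ}
    (hJ : ∀ j, J ≤ j → P.coeff j = 0) :
    pairing F k P = ∑ j ∈ Finset.range J, coeffZ F (k + j) * P.coeff j := by
  have h₁ : pairing F k P = ∑ j ∈ P.support, coeffZ F (k + j) * P.coeff j := rfl
  rw [h₁]
  refine Finset.sum_subset (fun j hj => ?_) fun j _ hj => ?_
  · rw [Finset.mem_range]
    by_contra h
    exact Polynomial.mem_support_iff.1 hj (hJ j (by omega))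
  · rw [Polynomial.notMem_support_iff.1 hj, mul_zero]

theorem pairing_mul_X_pow (F : PowerSeries BInf) (k : ℤ) (P : Polynomial BInf) (a : ℕ) :
    pairing F k (P * Polynomial.X ^ a) = pairing F (k + a) P := by
  induction P using Polynomial.induction_on' with
  | add P Q hP hQ => rw [add_mul, map_add, map_add, hP, hQ]
  | monomial j c =>
    rw [Polynomial.monomial_mul_X_pow, pairing_monomial, pairing_monomial]
    congr 2
    push_cast
    ring

theorem coeff_ofPowerSeries_mul_toLaurent (F : PowerSeries BInf) (P : Polynomial BInf) (k : ℤ) :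
    (HahnSeries.ofPowerSeries ℤ BInf F * toLaurent P).coeff k = pairing F k P := by
  induction P using Polynomial.induction_on' with
  | add P Q hP hQ => rw [map_add, mul_add, HahnSeries.coeff_add, hP, hQ, map_add]
  | monomial j c =>
    have h₁ : toLaurent (Polynomial.monomial j c) = HahnSeries.single (-(j : ℤ)) c := by
      rw [toLaurent, Polynomial.aeval_monomial, HahnSeries.single_pow, HahnSeries.algebraMap_apply',
        PowerSeries.algebraMap_apply, HahnSeries.ofPowerSeries_C]
      simp [HahnSeries.C_apply, HahnSeries.single_mul_single]
    rw [h₁, pairing_monomial, HahnSeries.coeff_mul_single, PowerSeries.coeff_coe, coeffZ,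
      sub_neg_eq_add]
    congr 1
    split_ifs with h
    · rfl
    · rw [show (k + j).natAbs = (k + j).toNat by omega]

/-- This is the creation operator: H(z) σ̄₋(z) generates the products bₙ ∧ x. -/
theorem pairing_shiftBarHom {r : ℕ} {x : Ext} (hx : x ∈ ⋀[ℤ]^r M₀) (n : ℕ) :
    pairing (seriesH eInf) ((n : ℤ) - r) (shiftBarHom (hForm eInf x)) =
      (-1) ^ r * hForm eInf (ExteriorAlgebra.ι ℤ (b n) * x) := by
  rw [shiftBarHom_hForm, pairing_eq_sum (J := r + 1), ← sum_h_mul_coeff rfl hx]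
  · rfl
  · intro j hj
    have := coeff_hForm_eShiftBar (e := eInf) rfl hx j
    rw [if_neg (by omega)] at this
    exact (isUnit_one.neg.pow r).mul_right_eq_zero.1 this

theorem pairing_shiftBarHom_of_lt {r : ℕ} {x : Ext} (hx : x ∈ ⋀[ℤ]^r M₀) {k : ℤ}
    (hk : k + r < 0) :
    pairing (seriesH eInf) k (shiftBarHom (hForm eInf x)) = 0 := by
  rw [shiftBarHom_hForm, pairing_eq_sum (J := r + 1)]
  · refine Finset.sum_eq_zero fun j hj => ?_
    rw [Finset.mem_range] at hj
    rw [coeffZ_of_neg _ (by omega), zero_mul]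
  · intro j hj
    have := coeff_hForm_eShiftBar (e := eInf) rfl hx j
    rw [if_neg (by omega)] at this
    exact (isUnit_one.neg.pow r).mul_right_eq_zero.1 this

theorem ι_mul_mem {r : ℕ} {x : Ext} (hx : x ∈ ⋀[ℤ]^r M₀) (v : M₀) :
    ExteriorAlgebra.ι ℤ v * x ∈ ⋀[ℤ]^(r + 1) M₀ := by
  rw [ExteriorAlgebra.exteriorPower, pow_succ']
  exact Submodule.mul_mem_mul ⟨v, rfl⟩ hx

/-! ### The Schur determinants span B_∞. -/

/-- The span of the Schur determinants is closed under multiplication by the `h_n`. -/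
theorem h_mul_hForm_mem {r : ℕ} {x : Ext} (hx : x ∈ ⋀[ℤ]^r M₀) (n : ℕ) :
    h eInf n * hForm eInf x ∈ LinearMap.range schurSumInf := by
  have h₁ : h eInf n * hForm eInf x =
      pairing (seriesH eInf) n (Polynomial.C (hForm eInf x)) := by
    rw [← Polynomial.monomial_zero_left, pairing_monomial]
    simp [h_eq_coeffZ]
  -- Inserting σ̄₋σ₋ = 1 writes hₙ p as a sum of creation operators applied to the coefficients of
  -- σ₋ p.
  rw [h₁, ← shiftBarHom_shiftHom, Polynomial.eval₂_eq_sum, Polynomial.sum, map_sum]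
  refine Submodule.sum_mem _ fun a _ => ?_
  rw [pairing_mul_X_pow]
  change pairing _ _ (shiftBarHom _) ∈ _
  have hy := hasseSchmidt_coeff_mem shiftMinus r x hx a
  have h₂ : (shiftHom (hForm eInf x)).coeff a = hForm eInf ((hasseSchmidt shiftMinus x).coeff a) := by
    rw [shiftHom_hForm, ← polyMap_sigmaMinus rfl hx, coeff_polyMap]
    rfl
  have h₃ := pairing_shiftBarHom hy (n + a + r)
  rw [show ((n + a + r : ℕ) : ℤ) - r = n + a by push_cast; ring] at h₃
  rw [h₂, h₃]
  have h₄ := hForm_mem_range_schurSumInf (ι_mul_mem hy (b (n + a + r)))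
  rcases neg_one_pow_eq_or BInf r with h | h <;> rw [h]
  · rwa [one_mul]
  · rw [neg_one_mul]
    exact Submodule.neg_mem _ h₄

theorem h_mul_mem_range {p : BInf} (hp : p ∈ LinearMap.range schurSumInf) (n : ℕ) :
    h eInf n * p ∈ LinearMap.range schurSumInf := by
  obtain ⟨a, rfl⟩ := hp
  rw [schurSumInf, Finsupp.linearCombination_apply, Finsupp.sum, Finset.mul_sum]
  refine Submodule.sum_mem _ fun l _ => ?_
  rw [mul_smul_comm, ← hForm_wedge_eInf l le_rfl]
  exact Submodule.smul_mem _ _ (h_mul_hForm_mem (wedge _ l).2 n)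

/-- The relation E(z) H(z) = 1 expresses e_{n+1} through products of a lower e_t and an h. -/
theorem eInf_mul_mem_range (n : ℕ) {p : BInf} (hp : p ∈ LinearMap.range schurSumInf) :
    eInf n * p ∈ LinearMap.range schurSumInf := by
  induction n using Nat.strong_induction_on generalizing p with
  | _ n ih =>
    cases n with
    | zero => simpa [eInf] using hp
    | succ n =>
      have h₁ := sum_e_mul_h (e := eInf) rfl ((n + 1 : ℕ) : ℤ) (n + 2) (by push_cast; omega)
      rw [if_neg (by omega), Finset.sum_range_succ, sub_self, h_zero rfl, mul_one] at h₁
      have h₂ : (-1) ^ (n + 1) * (eInf (n + 1) * p) = -∑ t ∈ Finset.range (n + 1),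
          (-1) ^ t * (eInf t * (h eInf ((n + 1 - t : ℕ) : ℤ) * p)) := by
        rw [← mul_assoc, eq_neg_of_add_eq_zero_right h₁, neg_mul, Finset.sum_mul]
        refine congrArg _ (Finset.sum_congr rfl fun t ht => ?_)
        rw [Finset.mem_range] at ht
        rw [Nat.cast_sub (by omega)]
        ring
      have hsign : ∀ (t : ℕ) (q : BInf), (-1) ^ t * q ∈ LinearMap.range schurSumInf ↔
          q ∈ LinearMap.range schurSumInf := by
        intro t q
        rcases neg_one_pow_eq_or BInf t with h | h <;> simp only [h, one_mul, neg_mul, neg_mem_iff]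
      rw [← hsign (n + 1), h₂]
      refine Submodule.neg_mem _ (Submodule.sum_mem _ fun t ht => ?_)
      rw [hsign]
      exact ih t (Finset.mem_range.1 ht) (h_mul_mem_range hp _)

theorem schurSumInf_surjective : Function.Surjective schurSumInf := by
  have key : ∀ q : BInf, ∀ p ∈ LinearMap.range schurSumInf,
      q * p ∈ LinearMap.range schurSumInf := by
    intro q
    induction q using MvPolynomial.induction_on with
    | C a =>
      intro p hp
      rw [← MvPolynomial.smul_eq_C_mul]
      exact Submodule.smul_mem _ a hp
    | add q q' hq hq' =>
      intro p hp
      rw [add_mul]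
      exact Submodule.add_mem _ (hq p hp) (hq' p hp)
    | mul_X q n hq =>
      intro p hp
      rw [mul_assoc]
      exact hq _ (eInf_mul_mem_range (n + 1) hp)
  intro q
  have h1 : (1 : BInf) ∈ LinearMap.range schurSumInf := by
    have h₁ : (1 : Ext) ∈ ⋀[ℤ]^0 M₀ := by
      rw [ExteriorAlgebra.exteriorPower, pow_zero]
      exact Submodule.one_le.1 le_rfl
    have := hForm_mem_range_schurSumInf h₁
    rw [← ExteriorAlgebra.ιMulti_zero_apply (R := ℤ) (M := M₀) 0, hForm, detForm_ιMulti] at this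
    simpa using this
  simpa using key q 1 h1

theorem onBInf_eq {f : M₀ →ₗ[ℤ] (ℕ →₀ M₀)} {S : BInf →ₐ[ℤ] Polynomial BInf}
    (h : ∀ (r : ℕ) (x : Ext), x ∈ ⋀[ℤ]^r M₀ →
      polyMap (hForm eInf) (hasseSchmidt f x) = S (hForm eInf x)) (p : BInf) :
    onBInf f p = S p := by
  conv_rhs => rw [← Function.rightInverse_invFun schurSumInf_surjective p]
  rw [onBInf, schurSumInf, Finsupp.linearCombination_apply, Finsupp.sum, Finsupp.sum, map_sum]
  refine Finset.sum_congr rfl fun l _ => ?_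
  rw [map_zsmul, ← hForm_wedge_eInf l le_rfl, ← h _ _ (wedge _ l).2, polyMap_apply]
  congr 1
  refine Finset.sum_congr rfl fun k _ => ?_
  rw [toBInf_eq]
  rfl

theorem sigmaMinusB_eq (p : BInf) : sigmaMinusB p = shiftHom p :=
  onBInf_eq (fun r x hx => by rw [shiftHom_hForm]; exact polyMap_sigmaMinus rfl hx) p

theorem sigmaBarMinusB_eq (p : BInf) : sigmaBarMinusB p = shiftBarHom p :=
  onBInf_eq (fun r x hx => by rw [shiftBarHom_hForm]; exact polyMap_sigmaBarMinus rfl hx) p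

/-! ### The residue -/

theorem coeff_gamma {r : ℕ} {x : Ext} (hx : x ∈ ⋀[ℤ]^r M₀) (n : ℕ) :
    (gamma (hForm eInf x)).coeff ((n : ℤ) - r) =
      (-1) ^ r * hForm eInf (ExteriorAlgebra.ι ℤ (b n) * x) := by
  rw [gamma, coeff_ofPowerSeries_mul_toLaurent, sigmaBarMinusB_eq, pairing_shiftBarHom hx]

theorem coeff_gamma_of_lt {r : ℕ} {x : Ext} (hx : x ∈ ⋀[ℤ]^r M₀) {k : ℤ} (hk : k + r < 0) :
    (gamma (hForm eInf x)).coeff k = 0 := by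
  rw [gamma, coeff_ofPowerSeries_mul_toLaurent, sigmaBarMinusB_eq, pairing_shiftBarHom_of_lt hx hk]

/-- The coefficients of σ₋(z) p are, up to sign, the sums Y_c = ∑ h_{i-c} · image(βᵢ ⌟ x) with c ≥
r. As Y_c = 0 for c < r, the whole family is known, and E(z) H(z) = 1 inverts it. -/
theorem coeff_gammaStar {r : ℕ} {x : Ext} (hx : x ∈ ⋀[ℤ]^(r + 1) M₀) (n : ℕ) :
    (gammaStar (hForm eInf x)).coeff ((r : ℤ) - n) =
      (-1) ^ r * hForm eInf (contractions x n) := by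
  rw [gammaStar, coeff_ofPowerSeries_mul_toLaurent, sigmaMinusB_eq, shiftHom_hForm]
  set P := hForm (eShift eInf) x with hP
  obtain ⟨J, hJn, hJP, hJx⟩ : ∃ J : ℕ, n ≤ J ∧ (∀ j, J ≤ j → P.coeff j = 0) ∧
      ∀ i ∈ (contractions x).support, i < J := by
    refine ⟨n + (P.natDegree + 1) + ((contractions x).support.sup id + 1), by omega,
      fun j hj => Polynomial.coeff_eq_zero_of_natDegree_lt (by omega), fun i hi => ?_⟩
    have := Finset.le_sup (f := id) hi
    simp only [id] at this
    omega
  rw [pairing_eq_sum _ _ _ hJP]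
  let Y : ℕ → BInf := fun c =>
    contractSum ((LinearMap.mul ℤ BInf).flip.compl₁₂ (hForm eInf) (hRow eInf c)) x
  have hY : ∀ c, Y c = ∑ i ∈ (contractions x).support,
      h eInf ((i : ℤ) - c) * hForm eInf (contractions x i) := by
    intro c
    simp only [Y, contractSum_apply]
    refine Finset.sum_congr rfl fun i _ => ?_
    simp only [LinearMap.compl₁₂_apply, LinearMap.flip_apply, LinearMap.mul_apply']
    rw [← hRow_b]
    rfl
  have hY0 : ∀ c < r, Y c = 0 := fun c hc => contractSum_hRow_eq_zero eInf hc hx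
  have hYr : ∀ j, Y (r + j) = (-1) ^ r * P.coeff j := fun j =>
    contractSum_hRow_eq_coeff rfl hx j
  have h1 : ((-1 : BInf) ^ r) * (-1) ^ r = 1 := by rw [← mul_pow]; simp
  have h₁ : ∑ j ∈ Finset.range J, coeffZ (seriesE eInf) ((r : ℤ) - n + j) * P.coeff j =
      (-1) ^ r * ∑ c ∈ Finset.range (r + J), coeffZ (seriesE eInf) ((c : ℤ) - n) * Y c := by
    rw [Finset.sum_range_add, Finset.sum_eq_zero (s := Finset.range r), zero_add, Finset.mul_sum]
    · refine Finset.sum_congr rfl fun j _ => ?_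
      rw [hYr, show ((r + j : ℕ) : ℤ) - n = r - n + j by push_cast; ring]
      linear_combination (-coeffZ (seriesE eInf) ((r : ℤ) - n + j) * P.coeff j) * h1
    · intro c hc
      rw [hY0 c (Finset.mem_range.1 hc), mul_zero]
  have h₂ : ∑ c ∈ Finset.range (r + J), coeffZ (seriesE eInf) ((c : ℤ) - n) * Y c =
      ∑ i ∈ (contractions x).support, (if (i : ℤ) - n = 0 then 1 else 0) *
        hForm eInf (contractions x i) := by
    simp only [hY, Finset.mul_sum]
    rw [Finset.sum_comm]
    refine Finset.sum_congr rfl fun i hi => ?_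
    have hi' := hJx i hi
    rw [← sum_e_mul_h (e := eInf) rfl _ (r + J - n) (by omega), Finset.sum_mul,
      show r + J = n + (r + J - n) by omega, Finset.sum_range_add,
      Finset.sum_eq_zero (s := Finset.range n), zero_add, Nat.add_sub_cancel_left]
    · refine Finset.sum_congr rfl fun t _ => ?_
      rw [show ((n + t : ℕ) : ℤ) - n = (t : ℕ) by push_cast; ring, coeffZ_natCast,
        show (i : ℤ) - ((n + t : ℕ) : ℤ) = i - n - t by push_cast; ring, seriesE,
        PowerSeries.coeff_mk, mul_assoc]
      ring
    · intro c hc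
      rw [coeffZ_of_neg _ (by have := Finset.mem_range.1 hc; omega), zero_mul]
  rw [h₁, h₂]
  congr 1
  by_cases hn : n ∈ (contractions x).support
  · rw [Finset.sum_eq_single n]
    · simp
    · intro i _ hin
      rw [if_neg (by omega), zero_mul]
    · exact fun h => absurd hn h
  · rw [Finsupp.notMem_support_iff.1 hn, map_zero]
    refine Finset.sum_eq_zero fun i hi => ?_
    rw [if_neg (fun h => hn ?_), zero_mul]
    rwa [show n = i by omega]

theorem residue_eq {r : ℕ} {x : Ext} (hx : x ∈ ⋀[ℤ]^(r + 1) M₀) :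
    residue (tensorSeries (gammaStar (hForm eInf x)) (gamma (hForm eInf x))) =
      -TensorProduct.map (hForm eInf) (hForm eInf) (plucker x) := by
  set f := gammaStar (hForm eInf x)
  set g := gamma (hForm eInf x)
  let F : ℤ × ℤ → BInf ⊗[ℤ] BInf := fun ij => f.coeff ij.1 ⊗ₜ[ℤ] g.coeff ij.2
  -- The exponents of βₙ ⌟ x and bₙ ∧ x add up to -1, and the signs (-1)^r and (-1)^(r+1) multiply
  -- to -1.
  let φ : ℕ → ℤ × ℤ := fun n => ((r : ℤ) - n, (n : ℤ) - (r + 1 : ℕ))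
  have hφ : Function.Injective φ := fun n n' h => by
    have := congrArg Prod.fst h
    simp only [φ] at this
    omega
  have hF' : ∀ ij, (Algebra.TensorProduct.includeLeft : BInf →ₐ[ℤ] BInf ⊗[ℤ] BInf) (f.coeff ij.1) *
      (Algebra.TensorProduct.includeRight : BInf →ₐ[ℤ] BInf ⊗[ℤ] BInf) (g.coeff ij.2) = F ij :=
    fun ij => by simp [F]
  have hF : ∀ n, F (φ n) = -(hForm eInf (contractions x n) ⊗ₜ[ℤ]
      hForm eInf (ExteriorAlgebra.ι ℤ (b n) * x)) := by
    intro n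
    simp only [F, φ, f, g]
    rw [coeff_gammaStar hx, coeff_gamma hx, pow_succ]
    rcases neg_one_pow_eq_or BInf r with h | h <;>
      simp [h, TensorProduct.tmul_neg, TensorProduct.neg_tmul]
  rw [residue, tensorSeries, HahnSeries.coeff_mul, plucker_eq_sum, map_sum]
  simp only [HahnSeries.map_coeff, TensorProduct.map_tmul]
  rw [← Finset.sum_neg_distrib]
  have h₁ : ∑ n ∈ (contractions x).support, -(hForm eInf (contractions x n) ⊗ₜ[ℤ]
      hForm eInf (ExteriorAlgebra.ι ℤ (b n) * x)) =
      ∑ ij ∈ (contractions x).support.map ⟨φ, hφ⟩, F ij := by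
    rw [Finset.sum_map]
    exact Finset.sum_congr rfl fun n _ => (hF n).symm
  refine Eq.trans ?_ h₁.symm
  rw [Finset.sum_congr rfl fun ij _ => hF' ij]
  -- Both sums are compared with the sum over the union of their index sets.
  refine (Finset.sum_subset Finset.subset_union_left fun ij hij hij' => ?_).trans
    (Finset.sum_subset (s₁ := (contractions x).support.map ⟨φ, hφ⟩) Finset.subset_union_right
      fun ij hij hij' => ?_).symm
  · rcases Finset.mem_union.1 hij with h | h
    · exact absurd h hij'
    obtain ⟨n, hn, rfl⟩ := Finset.mem_map.1 h
    by_contra h0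
    refine hij' (Finset.mem_antidiagonal.2 ⟨?_, ?_, ?_⟩)
    · rw [HahnSeries.mem_support, HahnSeries.map_coeff]
      exact fun h => h0 ((hF' (φ n)).symm.trans (mul_eq_zero_of_left h _))
    · rw [HahnSeries.mem_support, HahnSeries.map_coeff]
      exact fun h => h0 ((hF' (φ n)).symm.trans (mul_eq_zero_of_right _ h))
    · simp only [Function.Embedding.coeFn_mk, φ]
      push_cast
      ring
  · rcases Finset.mem_union.1 hij with h | h
    · have hsum := (Finset.mem_antidiagonal.1 h).2.2
      by_cases hlt : ij.2 + (r + 1 : ℕ) < 0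
      · simp only [g, coeff_gamma_of_lt hx hlt, TensorProduct.tmul_zero]
      · obtain ⟨n, hn⟩ := Int.eq_ofNat_of_zero_le (not_lt.1 hlt)
        have hij₀ : ij = φ n := Prod.ext (by simp only [φ]; push_cast at hn; omega)
          (by simp only [φ]; omega)
        have hn' : n ∉ (contractions x).support := fun h' =>
          hij' (Finset.mem_map.2 ⟨n, h', hij₀.symm⟩)
        rw [hij₀]
        refine (hF n).trans ?_
        rw [Finsupp.notMem_support_iff.1 hn', map_zero, TensorProduct.zero_tmul, neg_zero]
    · exact absurd h hij'

/-- The form is injective only on single exterior powers (1 and b₀ have the same image), so the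
Plücker tensor is first lifted to ⋀ʳ ⊗ ⋀^{r+2}; flatness then keeps the tensor product of the two
injections injective. -/
theorem tensor_hForm_plucker_eq_zero {r : ℕ} {x : Ext} (hx : x ∈ ⋀[ℤ]^(r + 1) M₀)
    (h0 : TensorProduct.map (hForm eInf) (hForm eInf) (plucker x) = 0) : plucker x = 0 := by
  let A := ⋀[ℤ]^r M₀
  let A' := ⋀[ℤ]^(r + 2) M₀
  let u : A ⊗[ℤ] A' := ∑ i ∈ (contractions x).support,
    (⟨contractions x i, contract_mem hx _⟩ : A) ⊗ₜ[ℤ]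
      (⟨ExteriorAlgebra.ι ℤ (b i) * x, ι_mul_mem hx _⟩ : A')
  have hu : TensorProduct.map A.subtype A'.subtype u = plucker x := by
    rw [plucker_eq_sum, map_sum]
    rfl
  have hinj : ∀ s : ℕ, Function.Injective (hForm eInf ∘ₗ (⋀[ℤ]^s M₀).subtype) := fun s =>
    (injective_iff_map_eq_zero _).2 fun y hy => Subtype.ext (eq_zero_of_hForm_eInf y.2 hy)
  have h₁ : TensorProduct.map (hForm eInf ∘ₗ A.subtype) (hForm eInf ∘ₗ A'.subtype) u = 0 := by
    rw [TensorProduct.map_comp, LinearMap.comp_apply, hu, h0]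
  have h₂ : u = 0 := by
    refine (injective_iff_map_eq_zero _).1
      (TensorProduct.map_injective_of_flat_flat _ _ (hinj r) (hinj (r + 2))) u h₁
  rw [← hu, h₂, map_zero]

theorem residue_eq_zero_iff {r : ℕ} (x : ⋀[ℤ]^(r + 1) M₀) :
    residue (tensorSeries (gammaStar (hForm eInf x)) (gamma (hForm eInf x))) = 0 ↔
      x ∈ grassmannCone (r + 1) := by
  rw [residue_eq x.2, neg_eq_zero, mem_grassmannCone_iff]
  exact ⟨tensor_hForm_plucker_eq_zero x.2, fun h => by rw [h, map_zero]⟩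

/-! ### Comparison of B_s, B_∞ and ⋀ˢ M₀. -/

/-- Any Schur expansion of the given polynomial yields the same vector, by injectivity of `hForm (e
s)` on ⋀ˢ M₀. -/
theorem phi_hForm {s : ℕ} (x : ⋀[ℤ]^s M₀) : phi s (hForm (e s) x) = x := by
  have h₁ : ∀ a, schurSum s a = hForm (e s) (wedgeSum s a) := fun a => by
    rw [hForm_wedgeSum, schurSum, Finsupp.linearCombination_apply]
  obtain ⟨a, rfl⟩ := wedgeSum_surjective s x
  rw [phi]
  have h₂ := Function.invFun_eq (f := schurSum s) ⟨a, h₁ a⟩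
  rw [h₁] at h₂
  refine Subtype.ext (sub_eq_zero.1 (eq_zero_of_hForm_e
    (Submodule.sub_mem _ (wedgeSum s _).2 (wedgeSum s _).2) ?_))
  rw [map_sub, h₂, sub_self]

/-- The map `B_∞ → B_s` that sends `eₙ` to `0` for `n > s`. -/
def truncB (s : ℕ) : BInf →ₐ[ℤ] B s := MvPolynomial.aeval fun n => e s (n + 1)

theorem truncB_eInf (s n : ℕ) : truncB s (eInf n) = e s n := by
  cases n with
  | zero => simp [eInf, e]
  | succ n => simp [eInf, truncB]

theorem truncB_inclB {s : ℕ} (q : B s) : truncB s (inclB s q) = q := by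
  have : (truncB s).comp (inclB s) = AlgHom.id ℤ (B s) := by
    refine MvPolynomial.algHom_ext fun i => ?_
    simp [truncB, inclB, e]
  exact DFunLike.congr_fun this q

theorem truncB_hForm (s : ℕ) (x : Ext) : truncB s (hForm eInf x) = hForm (e s) x := by
  have := map_hForm (truncB s).toRingHom (e := eInf) rfl x
  simpa [truncB_eInf] using this

theorem exists_inclB_eq (p : BInf) : ∃ s₀, ∀ s ≥ s₀, ∃ q : B s, inclB s q = p := by
  refine ⟨p.vars.sup id + 1, fun s hs =>
    MvPolynomial.exists_rename_eq_of_vars_subset_range p Fin.val Fin.val_injective fun i hi => ?_⟩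
  have := Finset.le_sup (f := id) hi
  simp only [id] at this
  exact ⟨⟨i, by omega⟩, rfl⟩

theorem exists_hForm_eq (p : BInf) :
    ∃ s₀, ∀ s ≥ s₀, ∃ x : ⋀[ℤ]^s M₀, hForm eInf x = p := by
  obtain ⟨a, rfl⟩ := schurSumInf_surjective p
  refine ⟨a.support.sup Part.length, fun s hs => ⟨a.sum fun l c => c • wedge s l, ?_⟩⟩
  rw [schurSumInf, Finsupp.linearCombination_apply, Finsupp.sum, Finsupp.sum]
  rw [Submodule.coe_sum, map_sum]
  refine Finset.sum_congr rfl fun l hl => ?_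
  rw [Submodule.coe_smul, map_smul, hForm_wedge_eInf l ((Finset.le_sup hl).trans hs)]

theorem phi_eq_of_hForm_eq {s : ℕ} {p : BInf} {x : ⋀[ℤ]^s M₀} (hx : hForm eInf x = p) {q : B s}
    (hq : inclB s q = p) : phi s q = x := by
  rw [← phi_hForm x, ← truncB_hForm, hx, ← hq, truncB_inclB]

end GrassmannKP

end

theorem mainTheorem4 (p : GrassmannKP.BInf) :
    GrassmannKP.CorrespondsToCone p ↔
      GrassmannKP.residue (GrassmannKP.tensorSeries (GrassmannKP.gammaStar p) (GrassmannKP.gamma p)) = 0 := by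
  obtain ⟨s₁, h₁⟩ := GrassmannKP.exists_hForm_eq p
  obtain ⟨s₂, h₂⟩ := GrassmannKP.exists_inclB_eq p
  constructor
  · rintro ⟨s₀, h₀⟩
    -- This degree exceeds both bounds and is positive, as the residue criterion requires.
    obtain ⟨q, hq, hcone⟩ := h₀ (s₀ + s₁ + 1) (by omega)
    obtain ⟨x, hx⟩ := h₁ (s₀ + s₁ + 1) (by omega)
    rw [GrassmannKP.phi_eq_of_hForm_eq hx hq, ← GrassmannKP.residue_eq_zero_iff, hx] at hcone
    exact hcone
  · intro h
    refine ⟨s₁ + s₂ + 1, fun s hs => ?_⟩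
    obtain ⟨r, rfl⟩ : ∃ r, s = r + 1 := ⟨s - 1, by omega⟩
    obtain ⟨x, hx⟩ := h₁ (r + 1) (by omega)
    obtain ⟨q, hq⟩ := h₂ (r + 1) (by omega)
    refine ⟨q, hq, ?_⟩
    rwa [GrassmannKP.phi_eq_of_hForm_eq hx hq, ← GrassmannKP.residue_eq_zero_iff, hx]
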